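/- Let $(x_i,y_i)$, $i\ge 1$, be i.i.d. with $x_i\in\mathbb R^d$, $y_i\in\mathbb R$ and $E(y_i\mid x_i)=\psi(\beta_t^Tx_i)$, where $\psi$ is twice continuously differentiable with $\dot\psi(t)=d\psi(t)/dt>0$ for all $t$. Let $\mathcal F_N=\{(x_i,y_i)\}_{i=1}^N$ be the full data, and let the full-data quasi-likelihood estimator $\hat\beta=\hat\beta_{\rm QLE}$ be the solution of $\sum_{i=1}^N\{y_i-\psi(\beta^Tx_i)\}x_i=0$. General Poisson subsampling uses probabilities $p_i=p_{N,i}\in(0,1]$, which may depend on $\mathcal F_N$; given $\mathcal F_N$ it draws independent indicators $\delta_i\sim\text{Bernoulli}(p_i)$, and $\tilde\beta$ is a solution of $$\sum_{i=1}^N\frac{\delta_i}{p_i}\{y_i-\psi(\beta^Tx_i)\}x_i=0$$ (arbitrary on the event that this equation has no solution in the parameter space $\Lambda$ below). Let $r=\sum_{i=1}^Np_i$ be the expected subsample size and put $$\Sigma_\psi(\beta)=\frac1N\sum_{i=1}^N\dot\psi(\beta^Tx_i)x_ix_i^T,\qquad e_i=y_i-\psi(\hat\beta^Tx_i),\qquad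 V_c=\frac1{N^2}\sum_{i=1}^N\Big(\frac1{p_i}-1\Big)e_i^2\,x_ix_i^T .$$ Assume: 1. $\Lambda=\{\beta\in\mathbb R^d:\|\beta\|_1\le B\}$ for a constant $B$; $\beta_t$ is an interior point of $\Lambda$; and, with probability tending to one, $\hat\beta$ exists and is an interior point of $\Lambda$. 2. $E\|x_1\|^9<\infty$, $E|y_1|^6<\infty$, $E\sup_{\beta\in\Lambda}\psi^6(\beta^Tx_1)<\infty$ and $E\sup_{\beta\in\Lambda}\dot\psi^6(\beta^Tx_1)<\infty$. 3. There is a constant $c>0$ such that, with probability tending to one as $N\to\infty$, $\inf_{\beta\in\Lambda}\lambda_{\min}\{\Sigma_\psi(\beta)\}\ge c$. 4. There are functions $m_1,m_2$ with $E\,m_1^3(x_1)<\infty$ and $E\,m_2(x_1)<\infty$ such that, almost surely, for all $i$ and all $\beta_1,\beta_2\in\Lambda$, $|\psi(\beta_1^Tx_i)-\psi(\beta_2^Tx_i)|\le m_1(x_i)\|\beta_1-\beta_2\|$ and $\|\dot\psi(\beta_1^Tx_i)x_ix_i^T-\dot\psi(\beta_2^Tx_i)x_ix_i^T\|_s\le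 m_2(x_i)\|\beta_1-\beta_2\|$, with $\|\cdot\|_s$ the spectral norm. 5. $\max_{1\le i\le N}(Np_i)^{-1}=O_P(r^{-1})$. 6. $V_c$ is nondegenerate at the rate $r^{-1}$: $V_c$ is invertible with probability tending to one, and $V_c^{-1}=O_P(r)$. Then, as $N\to\infty$ and $r\to\infty$ (in probability, if $r$ is random), conditionally on $\mathcal F_N$ in probability, $$V^{-1/2}(\tilde\beta-\hat\beta_{\rm QLE})\longrightarrow N(0,I)\quad\text{in distribution},\qquad V=\Sigma_\psi(\hat\beta)^{-1}V_c\,\Sigma_\psi(\hat\beta)^{-1},$$ that is, for every bounded continuous $f:\mathbb R^d\to\mathbb R$, $E[f(V^{-1/2}(\tilde\beta-\hat\beta))\mid\mathcal F_N]\to E f(Z)$ in probability, where $Z\sim N(0,I)$. -/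

import Mathlib

open MeasureTheory ProbabilityTheory Filter Topology
open scoped ENNReal RealInnerProductSpace MatrixOrder BoundedContinuousFunction unitInterval

noncomputable section

namespace PoissonQL

/-- Euclidean space `ℝᵈ`; `βᵀ x` is written `⟪β, x⟫`. -/
abbrev Vec (d : ℕ) : Type := EuclideanSpace ℝ (Fin d)

/-- A full data set of `N` observations `(xᵢ, yᵢ)`. -/
abbrev Data (d N : ℕ) : Type := Fin N → Vec d × ℝ

/-- The full data consisting of the first `N` observations at the sample point `ω`. -/
def fullData {d : ℕ} {Ω : Type*} (X : ℕ → Ω → Vec d) (Y : ℕ → Ω → ℝ) (N : ℕ) (ω : Ω) :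
    Data d N :=
  fun i => (X i ω, Y i ω)

/-- The parameter space: the closed `l₁` ball of radius `B`. -/
def paramBall (d : ℕ) (B : ℝ) : Set (Vec d) := {β | ∑ j, |β j| ≤ B}

/-- The residual `yᵢ - ψ(βᵀ xᵢ)`. -/
def resid {d N : ℕ} (ψ : ℝ → ℝ) (D : Data d N) (β : Vec d) (i : Fin N) : ℝ :=
  (D i).2 - ψ ⟪β, (D i).1⟫

/-- The full-data estimating function `Q(β) = ∑ᵢ {yᵢ - ψ(βᵀ xᵢ)} xᵢ`. -/
def fullScore {d N : ℕ} (ψ : ℝ → ℝ) (D : Data d N) (β : Vec d) : Vec d :=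
  ∑ i, resid ψ D β i • (D i).1

/-- The law of the inclusion indicators `δ = (δ₁, …, δ_N)` in Poisson subsampling with
probabilities `p`: independent, `δᵢ ∼ Bernoulli(pᵢ)`. When the `pᵢ` are computed from the full
data, this is the conditional law of `δ` given the full data. -/
def subsampleLaw {N : ℕ} (p : Fin N → I) : Measure (Fin N → Bool) :=
  Measure.pi fun i => bernoulliMeasure true false (p i)

/-- The weighted estimating function of the subsample,
`Q*(β) = ∑_{i : δᵢ = 1} pᵢ⁻¹ {yᵢ - ψ(βᵀ xᵢ)} xᵢ`. -/
def subsampleScore {d N : ℕ} (ψ : ℝ → ℝ) (D : Data d N) (p : Fin N → I) (δ : Fin N → Bool)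
    (β : Vec d) : Vec d :=
  ∑ i with δ i = true, ((p i : ℝ)⁻¹ * resid ψ D β i) • (D i).1

/-- The expected subsample size `r = ∑ᵢ pᵢ`. -/
def expSize {N : ℕ} (p : Fin N → I) : ℝ := ∑ i, (p i : ℝ)

/-- The matrix `x xᵀ`. -/
def outer {d : ℕ} (x : Vec d) : Matrix (Fin d) (Fin d) ℝ := Matrix.vecMulVec x x

/-- `Σ_ψ(β) = N⁻¹ ∑ᵢ ψ'(βᵀ xᵢ) xᵢ xᵢᵀ`. -/
def sigmaPsi {d N : ℕ} (ψ : ℝ → ℝ) (D : Data d N) (β : Vec d) : Matrix (Fin d) (Fin d) ℝ :=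
  (N : ℝ)⁻¹ • ∑ i, deriv ψ ⟪β, (D i).1⟫ • outer (D i).1

/-- `V_c = N⁻² ∑ᵢ eᵢ² xᵢ xᵢᵀ / pᵢ - N⁻² ∑ᵢ eᵢ² xᵢ xᵢᵀ` with `eᵢ = yᵢ - ψ(βᵀ xᵢ)`. -/
def varC {d N : ℕ} (ψ : ℝ → ℝ) (D : Data d N) (p : Fin N → I) (β : Vec d) :
    Matrix (Fin d) (Fin d) ℝ :=
  ((N : ℝ) ^ 2)⁻¹ • ∑ i, ((resid ψ D β i) ^ 2 / (p i : ℝ)) • outer (D i).1 -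
    ((N : ℝ) ^ 2)⁻¹ • ∑ i, (resid ψ D β i) ^ 2 • outer (D i).1

/-- `V = Σ_ψ(β)⁻¹ V_c Σ_ψ(β)⁻¹`. -/
def varV {d N : ℕ} (ψ : ℝ → ℝ) (D : Data d N) (p : Fin N → I) (β : Vec d) :
    Matrix (Fin d) (Fin d) ℝ :=
  (sigmaPsi ψ D β)⁻¹ * varC ψ D p β * (sigmaPsi ψ D β)⁻¹

/-- `V^{-1/2}`: the symmetric positive semidefinite square root of `V⁻¹`. -/
def invSqrt {d : ℕ} (V : Matrix (Fin d) (Fin d) ℝ) : Matrix (Fin d) (Fin d) ℝ :=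
  CFC.sqrt V⁻¹

/-- The action of a matrix on `ℝᵈ`, as an operator on Euclidean space (so that its norm is the
spectral norm of the matrix). -/
abbrev op {d : ℕ} (A : Matrix (Fin d) (Fin d) ℝ) : Vec d →L[ℝ] Vec d :=
  Matrix.toEuclideanCLM (𝕜 := ℝ) A

/-- `Z k = O_P(1)`: the real sequence `Z` is bounded in probability. -/
def BoundedInProb {Ω : Type*} [MeasurableSpace Ω] (P : Measure Ω) (Z : ℕ → Ω → ℝ) : Prop :=
  ∀ ε : ℝ≥0∞, 0 < ε → ∃ C : ℝ, ∀ᶠ k in atTop, P {ω | C < |Z k ω|} ≤ ε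

end PoissonQL

end

namespace PoissonQL

/-! For fixed data the only randomness lies in the independent weights `wt`, of mean `1` and
variance `1/p - 1`, so the core is a nonasymptotic bound for deterministic data. Let `b` be the
full-data root, `Q` the weighted score divided by `N`, and `S = sigmaPsi`, `W = varC` at `b`. As the
full score vanishes at `b`, `Q b` is a centred sum of independent terms with covariance `W`, and
balanced probabilities make it of order `r^{-1/2}`. The sampled Hessian differs from `S` by
`O(r^{-1/2})` and the Lipschitz condition controls the curvature. Hence, with high probability, `Q`
has exactly one root `β`, and `S (β - b) = Q b + O(r⁻¹)` (`Regular.norm_error_sub_le`).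

Algebraically `V^{-1/2} = G S` with `G W Gᵀ = 1` (`exists_invSqrt_eq_mul`), and nondegeneracy gives
`‖G‖ = O(r^{1/2})`. So the standardized error is `G (Q b)`, whose covariance is the identity, up to
`O(r^{-1/2})`; a Lyapunov bound on characteristic functions (`norm_integral_exp_sum_wt_sub_le`)
yields normality.

The estimate depends on the data only through `r` and the constants of `Regular`, so Lévy's
continuity theorem gives a threshold on `r` uniform over regular data
(`exists_expSize_forall_regular`). It remains that random data are regular with probability near
one: Markov's inequality for an integrable envelope bounds the moments, and the law of large numbers
with `mul_norm_sub_le_of_fullScore` keeps `b` away from the boundary. -/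

/-! ### Moments of the inverse probability weights. -/

/-- The inverse probability weight `δᵢ / pᵢ`. -/
noncomputable def wt {N : ℕ} (p : Fin N → I) (δ : Fin N → Bool) (i : Fin N) : ℝ :=
  if δ i = true then (p i : ℝ)⁻¹ else 0

instance {N : ℕ} (p : Fin N → I) : IsProbabilityMeasure (subsampleLaw p) := by
  unfold subsampleLaw; infer_instance

lemma integrable_subsampleLaw {N : ℕ} (p : Fin N → I) {E : Type*} [NormedAddCommGroup E]
    (f : (Fin N → Bool) → E) : Integrable f (subsampleLaw p) :=
  Integrable.of_finite

lemma integral_prod_subsampleLaw {N : ℕ} (p : Fin N → I) (f : Fin N → Bool → ℂ) :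
    ∫ δ, ∏ i, f i (δ i) ∂(subsampleLaw p)
      = ∏ i, ((p i : ℝ) * f i true + (1 - p i : ℝ) * f i false) := by
  unfold subsampleLaw
  rw [integral_fintype_prod_eq_prod]
  simp [integral_bernoulliMeasure]

lemma integral_eval_subsampleLaw {N : ℕ} (p : Fin N → I) (i : Fin N) (g : Bool → ℝ) :
    ∫ δ, g (δ i) ∂(subsampleLaw p) = (p i : ℝ) * g true + (1 - p i : ℝ) * g false := by
  have h := (measurePreserving_eval (fun i => bernoulliMeasure true false (p i)) i)
  have := integral_map (μ := subsampleLaw p) (φ := Function.eval i) (f := g)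
    h.measurable.aemeasurable (by fun_prop)
  unfold subsampleLaw at this ⊢
  rw [h.map_eq, integral_bernoulliMeasure] at this
  simpa using this.symm

lemma integral_wt {N : ℕ} {p : Fin N → I} (hp : ∀ i, 0 < p i) (i : Fin N) :
    ∫ δ, wt p δ i ∂(subsampleLaw p) = 1 := by
  have h : (p i : ℝ) ≠ 0 := (show (0 : ℝ) < p i from hp i).ne'
  refine (integral_eval_subsampleLaw p i (fun b => if b = true then (p i : ℝ)⁻¹ else 0)).trans ?_
  simp [h]

lemma integral_wt_sub_one_sq {N : ℕ} {p : Fin N → I} (hp : ∀ i, 0 < p i) (i : Fin N) :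
    ∫ δ, (wt p δ i - 1) * (wt p δ i - 1) ∂(subsampleLaw p) = (p i : ℝ)⁻¹ - 1 := by
  have h : (p i : ℝ) ≠ 0 := (show (0 : ℝ) < p i from hp i).ne'
  refine (integral_eval_subsampleLaw p i (fun b =>
    ((if b = true then (p i : ℝ)⁻¹ else 0) - 1) *
      ((if b = true then (p i : ℝ)⁻¹ else 0) - 1))).trans ?_
  simp only [if_true, Bool.false_eq_true, if_false]
  field_simp
  ring

lemma integral_wt_sub_one_mul {N : ℕ} {p : Fin N → I} (hp : ∀ i, 0 < p i) {i j : Fin N}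
    (hij : i ≠ j) :
    ∫ δ, (wt p δ i - 1) * (wt p δ j - 1) ∂(subsampleLaw p) = 0 := by
  have hind : iIndepFun (fun i (δ : Fin N → Bool) =>
      (fun b : Bool => (if b = true then (p i : ℝ)⁻¹ else 0) - 1) (δ i)) (subsampleLaw p) :=
    iIndepFun_pi (X := fun i (b : Bool) => (if b = true then (p i : ℝ)⁻¹ else 0) - 1)
      (fun i => (measurable_of_countable _).aemeasurable)
  have h := (hind.indepFun hij).integral_fun_mul_eq_mul_integral
    (integrable_subsampleLaw p _).aestronglyMeasurable
    (integrable_subsampleLaw p _).aestronglyMeasurable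
  have h0 : ∫ δ, (wt p δ i - 1) ∂(subsampleLaw p) = 0 := by
    rw [integral_sub (integrable_subsampleLaw p _) (integrable_subsampleLaw p _), integral_wt hp]
    simp
  unfold wt at h0 ⊢
  rw [h, h0, zero_mul]

/-- Independence kills the cross terms. This one variance formula serves both the score and the
columns of the Hessian. -/
lemma integral_norm_sum_wt_sub_one_sq {N : ℕ} {p : Fin N → I} (hp : ∀ i, 0 < p i)
    {E : Type*} [NormedAddCommGroup E] [InnerProductSpace ℝ E] (u : Fin N → E) :
    ∫ δ, ‖∑ i, (wt p δ i - 1) • u i‖ ^ 2 ∂(subsampleLaw p)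
      = ∑ i, ((p i : ℝ)⁻¹ - 1) * ‖u i‖ ^ 2 := by
  have h (δ : Fin N → Bool) : ‖∑ i, (wt p δ i - 1) • u i‖ ^ 2
      = ∑ i, ∑ j, ((wt p δ i - 1) * (wt p δ j - 1)) * ⟪u i, u j⟫ := by
    rw [← real_inner_self_eq_norm_sq, sum_inner]
    refine Finset.sum_congr rfl fun i _ => ?_
    rw [inner_sum]
    refine Finset.sum_congr rfl fun j _ => ?_
    rw [real_inner_smul_left, real_inner_smul_right]; ring
  simp_rw [h]
  rw [integral_finsetSum _ fun i _ => integrable_subsampleLaw p _]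
  refine Finset.sum_congr rfl fun i _ => ?_
  rw [integral_finsetSum _ fun i _ => integrable_subsampleLaw p _, Finset.sum_eq_single i]
  · rw [integral_mul_const, integral_wt_sub_one_sq hp, real_inner_self_eq_norm_sq]
  · intro j _ hj
    rw [integral_mul_const, integral_wt_sub_one_mul hp hj.symm, zero_mul]
  · simp

/-- Markov's inequality under the subsampling law. -/
lemma subsampleLaw_real_lt_le {N : ℕ} (p : Fin N → I) {f : (Fin N → Bool) → ℝ}
    (hf : ∀ δ, 0 ≤ f δ) {a m : ℝ} (ha : 0 < a) (hm : ∫ δ, f δ ∂(subsampleLaw p) ≤ m) :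
    (subsampleLaw p).real {δ | a < f δ} ≤ m / a := by
  have h := mul_meas_ge_le_integral_of_nonneg (Eventually.of_forall hf)
    (integrable_subsampleLaw p f) a
  rw [le_div_iff₀ ha, mul_comm]
  refine le_trans (mul_le_mul_of_nonneg_left ?_ ha.le) (h.trans hm)
  exact measureReal_mono fun δ (hδ : a < f δ) => hδ.le

/-! ### Characteristic functions and the Lyapunov bound. -/

lemma norm_exp_mul_I_sub_quadratic_le (x : ℝ) :
    ‖Complex.exp (x * Complex.I) - (1 + x * Complex.I - x ^ 2 / 2)‖ ≤ 4 * |x| ^ 3 := by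
  by_cases hx : |x| ≤ 1
  · have h := Complex.exp_bound (x := x * Complex.I) (by simpa using hx) (n := 3) (by norm_num)
    have h2 : ∑ m ∈ Finset.range 3, (x * Complex.I) ^ m / (m.factorial : ℂ)
        = 1 + x * Complex.I - x ^ 2 / 2 := by
      simp [Finset.sum_range_succ, Nat.factorial, mul_pow]; ring
    rw [h2] at h
    refine h.trans ?_
    simp only [norm_mul, Complex.norm_real, Real.norm_eq_abs, Complex.norm_I, mul_one]
    rw [mul_comm]
    gcongr
    norm_num [Nat.factorial]
  · push Not at hx
    have h1 : ‖Complex.exp (x * Complex.I)‖ = 1 := Complex.norm_exp_ofReal_mul_I x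
    have h2 : ‖(1 + x * Complex.I - x ^ 2 / 2 : ℂ)‖ ≤ 1 + |x| + |x| ^ 2 / 2 := by
      refine (norm_sub_le _ _).trans (add_le_add ((norm_add_le _ _).trans ?_) ?_) <;> simp
    refine (norm_sub_le _ _).trans ?_
    rw [h1]
    nlinarith [mul_pos (sub_pos.2 hx) (sub_pos.2 hx), sq_nonneg (|x|), pow_pos (zero_lt_one.trans hx) 3]

lemma abs_exp_neg_sub_le {u : ℝ} (hu : 0 ≤ u) : |Real.exp (-u) - (1 - u)| ≤ 2 * u ^ 2 := by
  by_cases h : u ≤ 1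
  · have := Real.norm_exp_sub_one_sub_id_le (x := -u) (by simpa [abs_of_nonneg hu] using h)
    simp only [Real.norm_eq_abs, sq_abs, abs_neg] at this
    rw [show Real.exp (-u) - (1 - u) = Real.exp (-u) - 1 - -u by ring]
    nlinarith
  · push Not at h
    have h1 := Real.exp_pos (-u)
    have h2 : Real.exp (-u) ≤ 1 := by simpa using hu
    rw [abs_le]; constructor <;> nlinarith

/-- Replace the factors one at a time; in the unit disc the other factors never amplify the error.
-/
lemma norm_prod_sub_prod_le {ι : Type*} (s : Finset ι) (a b : ι → ℂ) (ha : ∀ i, ‖a i‖ ≤ 1)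
    (hb : ∀ i, ‖b i‖ ≤ 1) : ‖∏ i ∈ s, a i - ∏ i ∈ s, b i‖ ≤ ∑ i ∈ s, ‖a i - b i‖ := by
  classical
  induction s using Finset.induction_on with
  | empty => simp
  | insert i s hi ih =>
    rw [Finset.prod_insert hi, Finset.prod_insert hi, Finset.sum_insert hi]
    have h : a i * ∏ i ∈ s, a i - b i * ∏ i ∈ s, b i
        = (a i - b i) * ∏ i ∈ s, a i + b i * (∏ i ∈ s, a i - ∏ i ∈ s, b i) := by ring
    rw [h]
    refine (norm_add_le _ _).trans (add_le_add ?_ ?_)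
    · rw [norm_mul, norm_prod]
      exact mul_le_of_le_one_right (norm_nonneg _)
        (Finset.prod_le_one (fun _ _ => norm_nonneg _) fun i _ => ha i)
    · rw [norm_mul]
      exact (mul_le_of_le_one_left (norm_nonneg _) (hb i)).trans ih

/-- Third order expansion of the characteristic function of a centred weighted indicator. -/
lemma norm_charFun_wt_sub_le {q : ℝ} (hq : 0 < q) (hq1 : q ≤ 1) (a s : ℝ)
    (hs : (q⁻¹ - 1) * a ^ 2 ≤ s ^ 2) (hs0 : 0 ≤ s) :
    ‖((q : ℂ) * Complex.exp (((q⁻¹ - 1) * a : ℝ) * Complex.I)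
        + (1 - q : ℝ) * Complex.exp (((0 - 1) * a : ℝ) * Complex.I))
      - (Real.exp (-((q⁻¹ - 1) * a ^ 2 / 2)) : ℂ)‖ ≤ (4 + s) * (|a| ^ 3 / q ^ 2) := by
  have hqi : 1 ≤ q⁻¹ := (one_le_inv₀ hq).2 hq1
  have h1 := norm_exp_mul_I_sub_quadratic_le ((q⁻¹ - 1) * a)
  have h2 := norm_exp_mul_I_sub_quadratic_le ((0 - 1) * a)
  have h3 := abs_exp_neg_sub_le (u := (q⁻¹ - 1) * a ^ 2 / 2)
    (by have := sub_nonneg.2 hqi; positivity)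
  have hqc : (q : ℂ) ≠ 0 := by exact_mod_cast hq.ne'
  set e1 := Complex.exp (((q⁻¹ - 1) * a : ℝ) * Complex.I)
  set e2 := Complex.exp (((0 - 1) * a : ℝ) * Complex.I)
  set e3 := Real.exp (-((q⁻¹ - 1) * a ^ 2 / 2))
  -- The linear terms cancel since the centred weight has mean zero, and the quadratic ones add up
  -- to its variance `q⁻¹ - 1`.
  have hdec : (q : ℂ) * e1 + (1 - q : ℝ) * e2 - (e3 : ℂ)
      = q * (e1 - (1 + ((q⁻¹ - 1) * a : ℝ) * Complex.I - ((q⁻¹ - 1) * a : ℝ) ^ 2 / 2))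
        + (1 - q : ℝ) * (e2 - (1 + ((0 - 1) * a : ℝ) * Complex.I - ((0 - 1) * a : ℝ) ^ 2 / 2))
        - ((e3 - (1 - (q⁻¹ - 1) * a ^ 2 / 2) : ℝ) : ℂ) := by
    push_cast
    field_simp
    ring
  rw [hdec]
  have hb1 : ‖(q : ℂ) * (e1 - (1 + ((q⁻¹ - 1) * a : ℝ) * Complex.I
      - ((q⁻¹ - 1) * a : ℝ) ^ 2 / 2))‖ ≤ q * (4 * |(q⁻¹ - 1) * a| ^ 3) := by
    rw [norm_mul, Complex.norm_real, Real.norm_eq_abs, abs_of_pos hq]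
    gcongr
  have hb2 : ‖((1 - q : ℝ) : ℂ) * (e2 - (1 + ((0 - 1) * a : ℝ) * Complex.I
      - ((0 - 1) * a : ℝ) ^ 2 / 2))‖ ≤ (1 - q) * (4 * |(0 - 1) * a| ^ 3) := by
    rw [norm_mul, Complex.norm_real, Real.norm_eq_abs, abs_of_nonneg (by linarith)]
    gcongr
  have hb3 : ‖((e3 - (1 - (q⁻¹ - 1) * a ^ 2 / 2) : ℝ) : ℂ)‖
      ≤ 2 * ((q⁻¹ - 1) * a ^ 2 / 2) ^ 2 := by
    rw [Complex.norm_real, Real.norm_eq_abs]; exact h3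
  refine (norm_sub_le _ _).trans ((add_le_add ((norm_add_le _ _).trans (add_le_add hb1 hb2))
    hb3).trans ?_)
  have e4 : |(q⁻¹ - 1) * a| ^ 3 = (q⁻¹ - 1) ^ 3 * |a| ^ 3 := by
    rw [abs_mul, abs_of_nonneg (by linarith), mul_pow]
  have e5 : |(0 - 1) * a| ^ 3 = |a| ^ 3 := by simp
  rw [e4, e5]
  have hA : 0 ≤ |a| ^ 3 := by positivity
  have hfirst : q * (4 * ((q⁻¹ - 1) ^ 3 * |a| ^ 3)) + (1 - q) * (4 * |a| ^ 3)
      ≤ 4 * (|a| ^ 3 / q ^ 2) := by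
    -- The left side is the third absolute moment of the centred weight.
    have : q * (q⁻¹ - 1) ^ 3 + (1 - q) ≤ 1 / q ^ 2 := by
      rw [le_div_iff₀ (by positivity)]
      have : (q * (q⁻¹ - 1) ^ 3 + (1 - q)) * q ^ 2 = (1 - q) ^ 3 + (1 - q) * q ^ 2 := by
        field_simp
      rw [this]
      nlinarith [mul_nonneg hq.le (sub_nonneg.2 hq1), mul_nonneg (mul_nonneg hq.le hq.le) (sub_nonneg.2 hq1)]
    calc _ = 4 * |a| ^ 3 * (q * (q⁻¹ - 1) ^ 3 + (1 - q)) := by ring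
      _ ≤ 4 * |a| ^ 3 * (1 / q ^ 2) := by gcongr
      _ = _ := by ring
  have hsecond : 2 * ((q⁻¹ - 1) * a ^ 2 / 2) ^ 2 ≤ s * (|a| ^ 3 / q ^ 2) := by
    -- The error of `exp (-u) ≈ 1 - u` is quartic in `a`. One factor `v * |a|` is a standard
    -- deviation, at most `s`; what is left is cubic, with `v ^ 3 ≤ q⁻²`.
    set v := Real.sqrt (q⁻¹ - 1) with hv
    have hv2 : v ^ 2 = q⁻¹ - 1 := Real.sq_sqrt (by linarith)
    have hv0 : 0 ≤ v := Real.sqrt_nonneg _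
    have hvs : v * |a| ≤ s := by
      refine abs_le_of_sq_le_sq' ?_ hs0 |>.2
      rw [mul_pow, hv2, sq_abs]; exact hs
    have hv3 : v ^ 3 ≤ (q ^ 2)⁻¹ := by
      have h6 : (v ^ 3) ^ 2 ≤ ((q ^ 2)⁻¹) ^ 2 := by
        have e : ((q ^ 2)⁻¹) ^ 2 = (q⁻¹) ^ 4 := by rw [← inv_pow]; ring
        rw [e, show (v ^ 3) ^ 2 = (v ^ 2) ^ 3 by ring, hv2]
        calc (q⁻¹ - 1) ^ 3 ≤ (q⁻¹) ^ 3 := by gcongr; linarith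
          _ ≤ (q⁻¹) ^ 4 := pow_le_pow_right₀ hqi (by norm_num)
      exact (abs_le_of_sq_le_sq' h6 (by positivity)).2
    calc 2 * ((q⁻¹ - 1) * a ^ 2 / 2) ^ 2 = (v * |a|) * (v ^ 3 * |a| ^ 3) / 2 := by
          rw [← hv2, ← sq_abs a]; ring
      _ ≤ (v * |a|) * (v ^ 3 * |a| ^ 3) := half_le_self (by positivity)
      _ ≤ s * ((q ^ 2)⁻¹ * |a| ^ 3) := by gcongr
      _ = _ := by ring
  linarith

/-- Lyapunov-type bound in the central limit theorem for Poisson subsampling. -/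
lemma norm_integral_exp_sum_wt_sub_le {N : ℕ} {p : Fin N → I} (hp : ∀ i, 0 < p i)
    (a : Fin N → ℝ) {s : ℝ} (hs0 : 0 ≤ s) (hs : ∑ i, ((p i : ℝ)⁻¹ - 1) * a i ^ 2 = s ^ 2) :
    ‖∫ δ, Complex.exp ((∑ i, (wt p δ i - 1) * a i : ℝ) * Complex.I) ∂(subsampleLaw p)
      - (Real.exp (-(s ^ 2 / 2)) : ℂ)‖ ≤ (4 + s) * ∑ i, |a i| ^ 3 / (p i : ℝ) ^ 2 := by
  have hq (i : Fin N) : (0 : ℝ) < p i := hp i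
  have hq1 (i : Fin N) : (p i : ℝ) ≤ 1 := (p i).2.2
  have hnn (i : Fin N) : 0 ≤ ((p i : ℝ)⁻¹ - 1) * a i ^ 2 :=
    mul_nonneg (sub_nonneg.2 ((one_le_inv₀ (hq i)).2 (hq1 i))) (sq_nonneg _)
  have h1 : ∫ δ, Complex.exp ((∑ i, (wt p δ i - 1) * a i : ℝ) * Complex.I) ∂(subsampleLaw p)
      = ∏ i, ((p i : ℝ) * Complex.exp ((((p i : ℝ)⁻¹ - 1) * a i : ℝ) * Complex.I)
        + (1 - p i : ℝ) * Complex.exp (((0 - 1) * a i : ℝ) * Complex.I)) := by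
    have := integral_prod_subsampleLaw p (fun i b => Complex.exp
      ((((if b = true then (p i : ℝ)⁻¹ else 0) - 1) * a i : ℝ) * Complex.I))
    simp only [if_true, Bool.false_eq_true, if_false] at this
    rw [← this]
    congr 1
    ext δ
    rw [← Complex.exp_sum, Complex.ofReal_sum, Finset.sum_mul]
    rfl
  have h2 : (Real.exp (-(s ^ 2 / 2)) : ℂ)
      = ∏ i, (Real.exp (-(((p i : ℝ)⁻¹ - 1) * a i ^ 2 / 2)) : ℂ) := by
    rw [← Complex.ofReal_prod, ← Real.exp_sum, ← hs]
    simp [Finset.sum_div]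
  rw [h1, h2, Finset.mul_sum]
  refine (norm_prod_sub_prod_le _ _ _ (fun i => ?_) fun i => ?_).trans
    (Finset.sum_le_sum fun i _ => ?_)
  · refine (norm_add_le _ _).trans ?_
    rw [norm_mul, norm_mul, Complex.norm_exp_ofReal_mul_I, Complex.norm_exp_ofReal_mul_I,
      Complex.norm_real, Complex.norm_real, Real.norm_eq_abs, Real.norm_eq_abs,
      abs_of_pos (hq i), abs_of_nonneg (by linarith [hq1 i])]
    linarith
  · rw [Complex.norm_real, Real.norm_eq_abs, abs_of_pos (Real.exp_pos _)]
    simpa using by have := hnn i; linarith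
  · exact norm_charFun_wt_sub_le (hq i) (hq1 i) (a i) s
      (hs ▸ Finset.single_le_sum (fun j _ => hnn j) (Finset.mem_univ i)) hs0

/-! ### Standardization by matrices. -/

section Matrices

variable {d : ℕ}

lemma posDef_of_sub_smul_one {M : Matrix (Fin d) (Fin d) ℝ} {c : ℝ} (hc : 0 < c)
    (h : (M - c • (1 : Matrix (Fin d) (Fin d) ℝ)).PosSemidef) : M.PosDef := by
  have := Matrix.PosDef.posSemidef_add h (Matrix.PosDef.smul (Matrix.PosDef.one) hc)
  simpa using this

lemma mul_norm_sq_le_inner_op {M : Matrix (Fin d) (Fin d) ℝ} {c : ℝ}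
    (h : (M - c • (1 : Matrix (Fin d) (Fin d) ℝ)).PosSemidef) (v : Vec d) :
    c * ‖v‖ ^ 2 ≤ ⟪v, op M v⟫ := by
  have h1 := h.dotProduct_mulVec_nonneg v
  rw [star_trivial, ← Matrix.inner_toEuclideanCLM] at h1
  simp only [map_sub, map_smul, map_one, _root_.sub_apply, inner_sub_right,
    _root_.smul_apply, one_apply_eq_self, real_inner_smul_right,
    real_inner_self_eq_norm_sq] at h1
  linarith

lemma inner_op_left (M : Matrix (Fin d) (Fin d) ℝ) (v w : Vec d) :
    ⟪op M v, w⟫ = ⟪v, op M.transpose w⟫ := by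
  rw [real_inner_comm, Matrix.inner_toEuclideanCLM, Matrix.inner_toEuclideanCLM,
    Matrix.dotProduct_mulVec, dotProduct_comm, Matrix.mulVec_transpose]

lemma op_outer (x v : Vec d) : op (outer x) v = ⟪x, v⟫ • x := by
  ext j
  simp only [outer, Matrix.ofLp_toEuclideanCLM, Matrix.vecMulVec_mulVec, PiLp.smul_apply,
    PiLp.inner_apply]
  simp [dotProduct, mul_comm]

lemma op_smul_outer_sub (a a' : ℝ) (x v : Vec d) :
    op (a • outer x - a' • outer x) v = ((a - a') * ⟪x, v⟫) • x := by
  simp only [← sub_smul, map_smul, _root_.smul_apply, op_outer, smul_smul]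

/-- The standardizing matrix factors through the information matrix. -/
lemma exists_invSqrt_eq_mul {S W : Matrix (Fin d) (Fin d) ℝ} (hS : S.PosDef) (hW : W.PosDef) :
    ∃ G : Matrix (Fin d) (Fin d) ℝ, invSqrt (S⁻¹ * W * S⁻¹) = G * S ∧ G * W * G.transpose = 1 := by
  set V := S⁻¹ * W * S⁻¹ with hV
  have hSi : (S⁻¹).transpose = S⁻¹ := by
    have := hS.inv.isHermitian
    rwa [Matrix.IsHermitian, Matrix.conjTranspose_eq_transpose_of_trivial] at this
  have hVpos : V.PosDef := by
    have := (Matrix.IsUnit.posDef_star_right_conjugate_iff hS.inv.isUnit).2 hW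
    rwa [Matrix.star_eq_conjTranspose, Matrix.conjTranspose_eq_transpose_of_trivial, hSi] at this
  set A := invSqrt V with hA
  have hAA : A * A = V⁻¹ := CFC.sqrt_mul_sqrt_self _ hVpos.inv.posSemidef.nonneg
  have hAt : A.transpose = A := by
    have := (CFC.sqrt_nonneg V⁻¹).isSelfAdjoint
    rwa [isSelfAdjoint_iff, Matrix.star_eq_conjTranspose,
      Matrix.conjTranspose_eq_transpose_of_trivial] at this
  have hVu : IsUnit V.det := (Matrix.isUnit_iff_isUnit_det _).1 hVpos.isUnit
  have hSu : IsUnit S.det := (Matrix.isUnit_iff_isUnit_det _).1 hS.isUnit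
  refine ⟨A * S⁻¹, (Matrix.nonsing_inv_mul_cancel_right _ _ hSu).symm, ?_⟩
  -- Since one-sided inverses of square matrices are two-sided, this also gives `A V A = 1`, which
  -- is `G W Gᵀ = 1` for `G = A S⁻¹`.
  have h1 : A * (A * V) = 1 := by
    rw [← mul_assoc, hAA, Matrix.nonsing_inv_mul _ hVu]
  rw [Matrix.transpose_mul, hSi, hAt, ← mul_eq_one_comm.1 h1, hV]
  simp only [mul_assoc]

/-- With `u = Gᵀ t`, the identity `G W Gᵀ = 1` says `⟪u, W u⟫ = ‖t‖²`, while nondegeneracy says `⟪u,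
W u⟫ ≥ (c / r) ‖u‖²`. -/
lemma norm_op_transpose_sq_le {G W : Matrix (Fin d) (Fin d) ℝ} (hG : G * W * G.transpose = 1)
    {r c : ℝ} (hc : 0 < c)
    (h : (r • W - c • (1 : Matrix (Fin d) (Fin d) ℝ)).PosSemidef) (t : Vec d) :
    ‖op G.transpose t‖ ^ 2 ≤ r / c * ‖t‖ ^ 2 := by
  have h1 := mul_norm_sq_le_inner_op h (op G.transpose t)
  have h2 : ⟪op G.transpose t, op W (op G.transpose t)⟫ = ‖t‖ ^ 2 := by
    rw [inner_op_left, Matrix.transpose_transpose, ← mul_apply_eq_comp,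
      ← mul_apply_eq_comp, ← map_mul, ← map_mul, hG, map_one,
      one_apply_eq_self, real_inner_self_eq_norm_sq]
  simp only [map_smul, _root_.smul_apply, real_inner_smul_right] at h1
  rw [h2] at h1
  rw [div_mul_eq_mul_div, le_div_iff₀ hc]
  linarith

lemma norm_op_le_of_transpose {G : Matrix (Fin d) (Fin d) ℝ} {a : ℝ}
    (h : ∀ t : Vec d, ‖op G.transpose t‖ ≤ a * ‖t‖) (v : Vec d) : ‖op G v‖ ≤ a * ‖v‖ := by
  have h1 : ‖op G v‖ * ‖op G v‖ ≤ (a * ‖v‖) * ‖op G v‖ := by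
    rw [← real_inner_self_eq_norm_mul_norm, inner_op_left]
    refine (real_inner_le_norm _ _).trans ?_
    calc ‖v‖ * ‖op G.transpose (op G v)‖ ≤ ‖v‖ * (a * ‖op G v‖) := by gcongr; exact h _
      _ = _ := by ring
  rcases (norm_nonneg (op G v)).eq_or_lt with h0 | h0
  · rw [← h0]
    exact (norm_nonneg _).trans (h v)
  · exact le_of_mul_le_mul_right h1 h0

end Matrices

/-! ### Deterministic perturbation of roots. -/

section Roots

lemma norm_sub_linear_le_of_root {E : Type*} [NormedAddCommGroup E] {S H Q : E → E} {b : E} {h m : ℝ}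
    (hH : ∀ v, ‖H v - S v‖ ≤ h * ‖v‖) {β : E}
    (hQ : ‖Q β - Q b + H (β - b)‖ ≤ m * ‖β - b‖ ^ 2) (h0 : Q β = 0) :
    ‖Q b - S (β - b)‖ ≤ h * ‖β - b‖ + m * ‖β - b‖ ^ 2 := by
  have : Q b - S (β - b) = (H (β - b) - S (β - b)) - (Q β - Q b + H (β - b)) := by
    rw [h0]; abel
  rw [this]
  exact (norm_sub_le _ _).trans (add_le_add (hH _) hQ)

variable {E : Type*} [NormedAddCommGroup E] [InnerProductSpace ℝ E]

/-- A gradient field that points inward on a sphere vanishes somewhere inside. -/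
lemma exists_zero_of_inward [FiniteDimensional ℝ E] {F : E → ℝ} {q : E → E}
    (hF : ∀ β, HasFDerivAt F (innerSL ℝ (q β)) β) (b : E) {s : ℝ} (hs : 0 < s)
    (h : ∀ β, ‖β - b‖ = s → ⟪q β, β - b⟫ < 0) : ∃ β, ‖β - b‖ < s ∧ q β = 0 := by
  have hc : Continuous F := continuous_iff_continuousAt.2 fun β => (hF β).continuousAt
  obtain ⟨β, hβ, hmax⟩ := (isCompact_closedBall b s).exists_isMaxOn
    ⟨b, Metric.mem_closedBall_self hs.le⟩ hc.continuousOn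
  rw [mem_closedBall_iff_norm] at hβ
  rcases hβ.lt_or_eq with hlt | heq
  · refine ⟨β, hlt, ?_⟩
    have hloc : IsLocalMax F β := hmax.isLocalMax
      (mem_of_superset (Metric.isOpen_ball.mem_nhds (mem_ball_iff_norm.2 hlt))
        Metric.ball_subset_closedBall)
    have h0 := hloc.hasFDerivAt_eq_zero (hF β)
    have := congrArg (fun L : E →L[ℝ] ℝ => L (q β)) h0
    simpa using this
  · exfalso
    -- At a maximizer on the sphere the derivative towards the centre cannot be positive, but the
    -- inward condition makes it so.
    have h1 := hmax.localize.hasFDerivWithinAt_nonpos (hF β).hasFDerivWithinAt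
      (sub_mem_posTangentConeAt_of_segment_subset (x := β) (y := b)
        ((convex_closedBall b s).segment_subset (mem_closedBall_iff_norm.2 heq.le)
          (Metric.mem_closedBall_self hs.le)))
    have h2 := h β heq
    rw [innerSL_apply_apply, ← neg_sub, inner_neg_right] at h1
    linarith

variable {S H Q : E → E} {b : E} {c ρ s h m : ℝ}

/-- The drift `c` loses `c / 4` to the sampling error in the Hessian and `c / 4` to the
nonlinearity; `c / 2` survives. The bound is used on the sphere for existence of a root, and at the
root for its size. -/
lemma inner_le_of_linearization (hS : ∀ v, c * ‖v‖ ^ 2 ≤ ⟪v, S v⟫)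
    (hH : ∀ v, ‖H v - S v‖ ≤ h * ‖v‖) (hh : h ≤ c / 4) (hm : 0 ≤ m) (hms : m * s ≤ c / 4)
    {β : E} (hβ : ‖β - b‖ ≤ s) (hQ : ‖Q β - Q b + H (β - b)‖ ≤ m * ‖β - b‖ ^ 2) :
    ⟪Q β, β - b⟫ ≤ ‖Q b‖ * ‖β - b‖ - c / 2 * ‖β - b‖ ^ 2 := by
  set v := β - b
  have hdec : ⟪Q β, v⟫ = ⟪Q β - Q b + H v, v⟫ + ⟪Q b, v⟫ - ⟪H v - S v, v⟫ - ⟪v, S v⟫ := by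
    rw [real_inner_comm (S v) v]
    simp only [inner_add_left, inner_sub_left]; ring
  have h1 : ⟪Q β - Q b + H v, v⟫ ≤ c / 4 * ‖v‖ ^ 2 := by
    calc _ ≤ ‖Q β - Q b + H v‖ * ‖v‖ := real_inner_le_norm _ _
      _ ≤ (m * ‖v‖ ^ 2) * ‖v‖ := by gcongr
      _ = (m * ‖v‖) * ‖v‖ ^ 2 := by ring
      _ ≤ (m * s) * ‖v‖ ^ 2 := by gcongr
      _ ≤ _ := by gcongr
  have h2 := real_inner_le_norm (Q b) v
  have h3 : -⟪H v - S v, v⟫ ≤ c / 4 * ‖v‖ ^ 2 := by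
    rw [← inner_neg_left]
    calc _ ≤ ‖-(H v - S v)‖ * ‖v‖ := real_inner_le_norm _ _
      _ ≤ (h * ‖v‖) * ‖v‖ := by rw [norm_neg]; gcongr; exact hH v
      _ ≤ (c / 4 * ‖v‖) * ‖v‖ := by gcongr
      _ = _ := by ring
  have h4 := hS v
  rw [hdec]; linarith

lemma norm_sub_le_of_root (hc : 0 < c) (hS : ∀ v, c * ‖v‖ ^ 2 ≤ ⟪v, S v⟫)
    (hH : ∀ v, ‖H v - S v‖ ≤ h * ‖v‖) (hh : h ≤ c / 4) (hm : 0 ≤ m) (hms : m * s ≤ c / 4)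
    {β : E} (hβ : ‖β - b‖ ≤ s) (hQ : ‖Q β - Q b + H (β - b)‖ ≤ m * ‖β - b‖ ^ 2)
    (h0 : Q β = 0) : ‖β - b‖ ≤ 2 / c * ‖Q b‖ := by
  have h1 := inner_le_of_linearization hS hH hh hm hms hβ hQ
  rw [h0, inner_zero_left] at h1
  rcases (norm_nonneg (β - b)).eq_or_lt with hz | hz
  · rw [← hz]; positivity
  · have : c / 2 * ‖β - b‖ ≤ ‖Q b‖ := by
      refine le_of_mul_le_mul_right ?_ hz
      linarith
    rw [div_mul_eq_mul_div, le_div_iff₀ hc]; linarith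

end Roots

/-! ### The weighted score: potential, uniqueness of roots, linearization. -/

section Score

variable {d N : ℕ} {ψ : ℝ → ℝ} {D : Data d N} {p : Fin N → I}

lemma subsampleScore_eq (δ : Fin N → Bool) (β : Vec d) :
    subsampleScore ψ D p δ β = ∑ i, (wt p δ i * resid ψ D β i) • (D i).1 := by
  rw [subsampleScore, Finset.sum_filter]
  refine Finset.sum_congr rfl fun i _ => ?_
  by_cases h : δ i = true <;> simp [wt, h]

lemma wt_nonneg (δ : Fin N → Bool) (i : Fin N) : 0 ≤ wt p δ i := by
  unfold wt
  split_ifs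
  · exact inv_nonneg.2 (p i).2.1
  · rfl

/-- The normalized Hessian of the weighted log quasi-likelihood, applied to `v`. -/
noncomputable def subsampleHess (ψ : ℝ → ℝ) (D : Data d N) (p : Fin N → I) (δ : Fin N → Bool)
    (β v : Vec d) : Vec d :=
  (N : ℝ)⁻¹ • ∑ i, (wt p δ i * deriv ψ ⟪β, (D i).1⟫ * ⟪(D i).1, v⟫) • (D i).1

lemma op_sigmaPsi (β v : Vec d) :
    op (sigmaPsi ψ D β) v = (N : ℝ)⁻¹ • ∑ i, (deriv ψ ⟪β, (D i).1⟫ * ⟪(D i).1, v⟫) • (D i).1 := by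
  simp only [sigmaPsi, map_smul, map_sum, _root_.smul_apply,
    _root_.sum_apply, op_outer, smul_smul]

/-- The potential is the weighted log quasi-likelihood, built from a primitive of `ψ`. It lets roots
be found by maximization instead of a fixed point theorem. -/
lemma exists_hasFDerivAt_subsampleScore (hψ : Continuous ψ) (δ : Fin N → Bool) (a : ℝ) :
    ∃ F : Vec d → ℝ, ∀ β, HasFDerivAt F (innerSL ℝ (a • subsampleScore ψ D p δ β)) β := by
  refine ⟨fun β => ∑ i, (a * wt p δ i) * ((D i).2 * ⟪β, (D i).1⟫ - ∫ t in (0)..⟪β, (D i).1⟫, ψ t),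
    fun β => ?_⟩
  have hlin (i : Fin N) : HasFDerivAt (fun β : Vec d => ⟪β, (D i).1⟫) (innerSL ℝ (D i).1) β := by
    have := (innerSL ℝ (D i).1).hasFDerivAt (x := β)
    refine this.congr_of_eventuallyEq (Eventually.of_forall fun γ => ?_)
    simp [real_inner_comm]
  have hterm (i : Fin N) := (((hlin i).const_mul (D i).2).sub
    ((hψ.integral_hasStrictDerivAt 0 ⟪β, (D i).1⟫).hasDerivAt.comp_hasFDerivAt β (hlin i))).const_mul
      (a * wt p δ i)
  refine (HasFDerivAt.fun_sum fun i _ => hterm i).congr_fderiv ?_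
  rw [subsampleScore_eq]
  ext v
  simp only [_root_.sum_apply, _root_.smul_apply,
    _root_.sub_apply, innerSL_apply_apply, real_inner_smul_left, sum_inner, smul_eq_mul,
    Finset.mul_sum, resid]
  exact Finset.sum_congr rfl fun i _ => by ring

/-- The weighted estimating equation has at most one root in `ℝᵈ` once the sampled covariates
span. -/
lemma subsampleScore_root_unique (hψ : StrictMono ψ) {δ : Fin N → Bool} {β₁ β₀ : Vec d}
    (h₁ : subsampleScore ψ D p δ β₁ = 0) (h₀ : subsampleScore ψ D p δ β₀ = 0)
    (hspan : ∀ v : Vec d, (∀ i, wt p δ i = 0 ∨ ⟪(D i).1, v⟫ = 0) → v = 0) : β₁ = β₀ := by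
  rw [← sub_eq_zero]
  refine hspan _ fun i => ?_
  -- The difference of the two scores is paired with `β₁ - β₀`. Monotonicity of `ψ` makes every
  -- summand nonnegative, so each one vanishes.
  have hsum : ∑ i, wt p δ i * ((ψ ⟪β₁, (D i).1⟫ - ψ ⟪β₀, (D i).1⟫) * ⟪(D i).1, β₁ - β₀⟫) = 0 := by
    have : ⟪subsampleScore ψ D p δ β₀ - subsampleScore ψ D p δ β₁, β₁ - β₀⟫ = 0 := by
      rw [h₁, h₀]; simp
    rw [subsampleScore_eq, subsampleScore_eq, ← Finset.sum_sub_distrib, sum_inner] at this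
    rw [← this]
    refine Finset.sum_congr rfl fun i _ => ?_
    rw [← sub_smul, real_inner_smul_left, resid, resid]; ring
  have hmono (i : Fin N) :
      0 ≤ (ψ ⟪β₁, (D i).1⟫ - ψ ⟪β₀, (D i).1⟫) * ⟪(D i).1, β₁ - β₀⟫ := by
    rw [inner_sub_right, real_inner_comm β₁ (D i).1, real_inner_comm β₀ (D i).1]
    rcases le_total ⟪β₁, (D i).1⟫ ⟪β₀, (D i).1⟫ with h | h
    · exact mul_nonneg_of_nonpos_of_nonpos (sub_nonpos.2 (hψ.monotone h)) (sub_nonpos.2 h)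
    · exact mul_nonneg (sub_nonneg.2 (hψ.monotone h)) (sub_nonneg.2 h)
  have := (Finset.sum_eq_zero_iff_of_nonneg fun i _ =>
    mul_nonneg (wt_nonneg δ i) (hmono i)).1 hsum i (Finset.mem_univ i)
  rcases mul_eq_zero.1 this with h | h
  · exact Or.inl h
  rcases mul_eq_zero.1 h with h | h
  · right
    rw [inner_sub_right, real_inner_comm β₁ (D i).1, real_inner_comm β₀ (D i).1, hψ.injective (sub_eq_zero.1 h),
      sub_self]
  · exact Or.inr h

lemma exists_mem_segment_sub_eq_deriv_mul (hψ : Differentiable ℝ ψ) (x β b : Vec d) :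
    ∃ t ∈ Set.Icc (0 : ℝ) 1,
      ψ ⟪β, x⟫ - ψ ⟪b, x⟫ = deriv ψ ⟪b + t • (β - b), x⟫ * ⟪x, β - b⟫ := by
  have hd (t : ℝ) : HasDerivAt (fun t : ℝ => ψ ⟪b + t • (β - b), x⟫)
      (deriv ψ ⟪b + t • (β - b), x⟫ * ⟪x, β - b⟫) t := by
    have h1 : HasDerivAt (fun t : ℝ => ⟪b + t • (β - b), x⟫) ⟪x, β - b⟫ t := by
      simp only [inner_add_left, real_inner_smul_left]
      rw [real_inner_comm (β - b) x]
      simpa using ((hasDerivAt_id t).mul_const ⟪β - b, x⟫).const_add ⟪b, x⟫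
    exact (hψ _).hasDerivAt.comp t h1
  obtain ⟨t, ht, h⟩ := exists_hasDerivAt_eq_slope (fun t : ℝ => ψ ⟪b + t • (β - b), x⟫) _
    zero_lt_one (fun t _ => (hd t).continuousAt.continuousWithinAt) fun t _ => hd t
  refine ⟨t, Set.Ioo_subset_Icc_self ht, ?_⟩
  rw [h]; simp

/-- First order expansion of the weighted estimating function. -/
lemma norm_subsampleScore_linearization_le (hψ : Differentiable ℝ ψ) {δ : Fin N → Bool}
    {b : Vec d} {ρ : ℝ} {h : Fin N → ℝ} (hh : ∀ i, 0 ≤ h i)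
    (hlip : ∀ i (β : Vec d), ‖β - b‖ ≤ ρ → ‖op (deriv ψ ⟪β, (D i).1⟫ • outer (D i).1
      - deriv ψ ⟪b, (D i).1⟫ • outer (D i).1)‖ ≤ h i * ‖β - b‖)
    {β : Vec d} (hβ : ‖β - b‖ ≤ ρ) :
    ‖(N : ℝ)⁻¹ • subsampleScore ψ D p δ β - (N : ℝ)⁻¹ • subsampleScore ψ D p δ b
      + subsampleHess ψ D p δ b (β - b)‖
      ≤ ((N : ℝ)⁻¹ * ∑ i, wt p δ i * h i) * ‖β - b‖ ^ 2 := by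
  have hterm (i : Fin N) : ‖(ψ ⟪b, (D i).1⟫ - ψ ⟪β, (D i).1⟫
      + deriv ψ ⟪b, (D i).1⟫ * ⟪(D i).1, β - b⟫) • (D i).1‖ ≤ h i * ‖β - b‖ ^ 2 := by
    -- The intermediate point depends on `i`, which is harmless because the Lipschitz condition
    -- holds observation by observation.
    obtain ⟨t, ht, ht'⟩ := exists_mem_segment_sub_eq_deriv_mul hψ (D i).1 β b
    have hn : ‖b + t • (β - b) - b‖ ≤ ‖β - b‖ := by
      rw [add_sub_cancel_left, norm_smul, Real.norm_eq_abs, abs_of_nonneg ht.1]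
      exact mul_le_of_le_one_left (norm_nonneg _) ht.2
    have h1 := hlip i _ (hn.trans hβ)
    have h2 : (ψ ⟪b, (D i).1⟫ - ψ ⟪β, (D i).1⟫
      + deriv ψ ⟪b, (D i).1⟫ * ⟪(D i).1, β - b⟫) • (D i).1
        = - op (deriv ψ ⟪b + t • (β - b), (D i).1⟫ • outer (D i).1
          - deriv ψ ⟪b, (D i).1⟫ • outer (D i).1) (β - b) := by
      rw [op_smul_outer_sub, sub_mul, ← ht', ← neg_smul]
      congr 1; ring
    rw [h2, norm_neg]
    calc _ ≤ _ := ContinuousLinearMap.le_opNorm _ _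
      _ ≤ (h i * ‖β - b‖) * ‖β - b‖ := by
        gcongr
        exact h1.trans (mul_le_mul_of_nonneg_left hn (hh i))
      _ = _ := by ring
  have heq : (N : ℝ)⁻¹ • subsampleScore ψ D p δ β - (N : ℝ)⁻¹ • subsampleScore ψ D p δ b
      + subsampleHess ψ D p δ b (β - b) = (N : ℝ)⁻¹ • ∑ i, wt p δ i •
        ((ψ ⟪b, (D i).1⟫ - ψ ⟪β, (D i).1⟫
          + deriv ψ ⟪b, (D i).1⟫ * ⟪(D i).1, β - b⟫) • (D i).1) := by
    rw [subsampleHess, ← smul_sub, ← smul_add, subsampleScore_eq, subsampleScore_eq,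
      ← Finset.sum_sub_distrib, ← Finset.sum_add_distrib]
    congr 1
    refine Finset.sum_congr rfl fun i _ => ?_
    rw [← sub_smul, ← add_smul, smul_smul, resid, resid]
    congr 1; ring
  rw [heq, norm_smul, Real.norm_eq_abs, abs_of_nonneg (by positivity), mul_assoc, Finset.sum_mul]
  gcongr
  refine (norm_sum_le _ _).trans (Finset.sum_le_sum fun i _ => ?_)
  rw [norm_smul, Real.norm_eq_abs, abs_of_nonneg (wt_nonneg δ i), mul_assoc]
  exact mul_le_mul_of_nonneg_left (hterm i) (wt_nonneg δ i)

/-- The squared Frobenius distance between the sampled and the full information matrices. -/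
noncomputable def hessDev (ψ : ℝ → ℝ) (D : Data d N) (p : Fin N → I) (b : Vec d)
    (δ : Fin N → Bool) : ℝ :=
  ∑ k, ‖∑ i, (wt p δ i - 1) • ((N : ℝ)⁻¹ * (deriv ψ ⟪b, (D i).1⟫ *
    ⟪(D i).1, EuclideanSpace.basisFun (Fin d) ℝ k⟫)) • (D i).1‖ ^ 2

/-- The Frobenius norm dominates the spectral norm by Cauchy–Schwarz, and its second moment can be
computed column by column. -/
lemma norm_subsampleHess_sub_le (δ : Fin N → Bool) (b v : Vec d) :
    ‖subsampleHess ψ D p δ b v - op (sigmaPsi ψ D b) v‖ ≤ √(hessDev ψ D p b δ) * ‖v‖ := by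
  set g : Fin d → Vec d := fun k => ∑ i, (wt p δ i - 1) • ((N : ℝ)⁻¹ * (deriv ψ ⟪b, (D i).1⟫ *
    ⟪(D i).1, EuclideanSpace.basisFun (Fin d) ℝ k⟫)) • (D i).1 with hg
  have hv (x : Vec d) : ⟪x, v⟫ = ∑ k, v k * ⟪x, EuclideanSpace.basisFun (Fin d) ℝ k⟫ := by
    simp [PiLp.inner_apply]
  have h1 : subsampleHess ψ D p δ b v - op (sigmaPsi ψ D b) v = ∑ k, v k • g k := by
    rw [subsampleHess, op_sigmaPsi, ← smul_sub, ← Finset.sum_sub_distrib, Finset.smul_sum]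
    simp only [hg, Finset.smul_sum]
    rw [Finset.sum_comm]
    refine Finset.sum_congr rfl fun i _ => ?_
    simp only [smul_smul, ← sub_smul, ← Finset.sum_smul]
    congr 1
    rw [hv, ← sub_eq_zero, Finset.mul_sum, Finset.mul_sum, ← Finset.sum_sub_distrib,
      Finset.mul_sum, ← Finset.sum_sub_distrib]
    exact Finset.sum_eq_zero fun k _ => by ring
  rw [h1]
  calc ‖∑ k, v k • g k‖ ≤ ∑ k, ‖g k‖ * ‖v k‖ :=
        (norm_sum_le _ _).trans_eq (Finset.sum_congr rfl fun k _ => by rw [norm_smul, mul_comm])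
    _ ≤ √(∑ k, ‖g k‖ ^ 2) * √(∑ k, ‖v k‖ ^ 2) := Real.sum_mul_le_sqrt_mul_sqrt _ _ _
    _ = _ := by rw [← EuclideanSpace.norm_eq]; rfl

/-- The right side is the variance of the `u`-component of the normalized score at a full-data root,
so `varC` is its conditional covariance. -/
lemma inner_op_varC (b u : Vec d) :
    ⟪u, op (varC ψ D p b) u⟫
      = ∑ i, ((p i : ℝ)⁻¹ - 1) * ((N : ℝ)⁻¹ * resid ψ D b i * ⟪(D i).1, u⟫) ^ 2 := by
  simp only [varC, map_sub, map_smul, map_sum, _root_.smul_apply,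
    _root_.sum_apply, _root_.sub_apply, op_outer, inner_sub_right,
    real_inner_smul_right, inner_sum, Finset.mul_sum]
  rw [← Finset.sum_sub_distrib]
  refine Finset.sum_congr rfl fun i _ => ?_
  rw [real_inner_comm u]; ring

end Score

/-! ### Nonasymptotic analysis of a regular data set. -/

/-- Quantitative regularity of a full data set: `b` solves the full-data estimating equation well
inside the parameter space, `h` dominates the relevant sixth moments and the local Lipschitz
constants, and the subsampling probabilities are balanced and nondegenerate. -/
structure Regular {d N : ℕ} (ψ : ℝ → ℝ) (B : ℝ) (D : Data d N) (p : Fin N → I) (b : Vec d)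
    (h : Fin N → ℝ) (K c ρ C c' : ℝ) : Prop where
  prob_pos : ∀ i, 0 < p i
  score : fullScore ψ D b = 0
  ball : ∀ β : Vec d, ‖β - b‖ ≤ ρ → β ∈ paramBall d B
  eig : (sigmaPsi ψ D b - c • (1 : Matrix (Fin d) (Fin d) ℝ)).PosSemidef
  sum_le : ∑ i, h i ≤ K * N
  norm_le : ∀ i, ‖(D i).1‖ ^ 6 ≤ h i
  resid_le : ∀ i, resid ψ D b i ^ 6 ≤ h i
  deriv_le : ∀ i, deriv ψ ⟪b, (D i).1⟫ ^ 6 ≤ h i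
  lip : ∀ i, ∀ β ∈ paramBall d B, ‖op (deriv ψ ⟪β, (D i).1⟫ • outer (D i).1
    - deriv ψ ⟪b, (D i).1⟫ • outer (D i).1)‖ ≤ h i * ‖β - b‖
  weight : ∀ i, ((N : ℝ) * p i)⁻¹ ≤ C / expSize p
  nondeg : (expSize p • varC ψ D p b - c' • (1 : Matrix (Fin d) (Fin d) ℝ)).PosSemidef

lemma norm_exp_mul_I_sub_le (x y : ℝ) :
    ‖Complex.exp (x * Complex.I) - Complex.exp (y * Complex.I)‖ ≤ |x - y| := by
  have h : Complex.exp (x * Complex.I) - Complex.exp (y * Complex.I)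
      = Complex.exp (y * Complex.I) * (Complex.exp (Complex.I * (x - y : ℝ)) - 1) := by
    rw [mul_sub, ← Complex.exp_add]
    congr 2 <;> push_cast <;> ring
  rw [h, norm_mul, Complex.norm_exp_ofReal_mul_I, one_mul]
  exact Real.norm_exp_I_mul_ofReal_sub_one_le

lemma norm_integral_exp_sub_le {N : ℕ} (p : Fin N → I) (f g : (Fin N → Bool) → ℝ)
    (s : Set (Fin N → Bool)) {η : ℝ} (hη : 0 ≤ η) (h : ∀ δ ∉ s, |f δ - g δ| ≤ η) :
    ‖∫ δ, Complex.exp (f δ * Complex.I) ∂(subsampleLaw p)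
      - ∫ δ, Complex.exp (g δ * Complex.I) ∂(subsampleLaw p)‖
      ≤ η + 2 * (subsampleLaw p).real s := by
  rw [← integral_sub (integrable_subsampleLaw p _) (integrable_subsampleLaw p _)]
  have hs : MeasurableSet s := s.toFinite.measurableSet
  calc _ ≤ ∫ δ, ‖Complex.exp (f δ * Complex.I) - Complex.exp (g δ * Complex.I)‖
        ∂(subsampleLaw p) := norm_integral_le_integral_norm _
    _ ≤ ∫ δ, (η + s.indicator (fun _ => (2 : ℝ)) δ) ∂(subsampleLaw p) := by
      refine integral_mono (integrable_subsampleLaw p _) (integrable_subsampleLaw p _) fun δ => ?_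
      by_cases hδ : δ ∈ s
      · simp only [Set.indicator_of_mem hδ]
        refine (norm_sub_le _ _).trans ?_
        rw [Complex.norm_exp_ofReal_mul_I, Complex.norm_exp_ofReal_mul_I]
        linarith
      · simp only [Set.indicator_of_notMem hδ, add_zero]
        exact (norm_exp_mul_I_sub_le _ _).trans (h δ hδ)
    _ = _ := by
      rw [integral_add (integrable_subsampleLaw p _) (integrable_subsampleLaw p _),
        integral_indicator_const _ hs]
      simp [mul_comm]

namespace Regular

variable {d N : ℕ} {ψ : ℝ → ℝ} {B : ℝ} {D : Data d N} {p : Fin N → I} {b : Vec d}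
  {h : Fin N → ℝ} {K c ρ C c' : ℝ}

lemma nonneg (H : Regular ψ B D p b h K c ρ C c') (i : Fin N) : 0 ≤ h i :=
  (by positivity : 0 ≤ ‖(D i).1‖ ^ 6).trans (H.norm_le i)

lemma size_pos (hr : 0 < expSize p) : 0 < N := by
  rcases Nat.eq_zero_or_pos N with rfl | hN
  · simp [expSize] at hr
  · exact hN

lemma resid_sq_mul_le (H : Regular ψ B D p b h K c ρ C c') (i : Fin N) :
    resid ψ D b i ^ 2 * ‖(D i).1‖ ^ 2 ≤ 1 + 2 * h i := by
  have h1 : (resid ψ D b i ^ 2) ^ 3 ≤ h i := by rw [← pow_mul]; exact H.resid_le i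
  have h2 : (‖(D i).1‖ ^ 2) ^ 3 ≤ h i := by rw [← pow_mul]; exact H.norm_le i
  have h3 : 0 ≤ resid ψ D b i ^ 2 := sq_nonneg _
  have h4 : 0 ≤ ‖(D i).1‖ ^ 2 := sq_nonneg _
  have key (u : ℝ) (hu : 0 ≤ u) : 2 * u ^ 2 ≤ 1 + 2 * u ^ 3 := by
    nlinarith [mul_nonneg hu (sq_nonneg (u - 1)), sq_nonneg (u - 1), mul_nonneg hu (sq_nonneg u),
      sq_nonneg (2 * u - 1), mul_nonneg hu (sq_nonneg (2 * u - 1))]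
  nlinarith [sq_nonneg (resid ψ D b i ^ 2 - ‖(D i).1‖ ^ 2), key _ h3, key _ h4]

lemma deriv_sq_mul_le (H : Regular ψ B D p b h K c ρ C c') (i : Fin N) :
    deriv ψ ⟪b, (D i).1⟫ ^ 2 * ‖(D i).1‖ ^ 4 ≤ 1 + 2 * h i := by
  have h1 : (deriv ψ ⟪b, (D i).1⟫ ^ 2) ^ 3 ≤ h i := by rw [← pow_mul]; exact H.deriv_le i
  have h2 : (‖(D i).1‖ ^ 2) ^ 3 ≤ h i := by rw [← pow_mul]; exact H.norm_le i
  set u := deriv ψ ⟪b, (D i).1⟫ ^ 2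
  set v := ‖(D i).1‖ ^ 2
  have hu : 0 ≤ u := sq_nonneg _
  have hv : 0 ≤ v := sq_nonneg _
  rw [show ‖(D i).1‖ ^ 4 = v ^ 2 by simp only [v]; ring]
  have : u * v ^ 2 ≤ u ^ 3 + v ^ 3 := by
    rcases le_total u v with huv | huv
    · calc u * v ^ 2 ≤ v * v ^ 2 := by gcongr
        _ ≤ u ^ 3 + v ^ 3 := by nlinarith [pow_nonneg hu 3]
    · calc u * v ^ 2 ≤ u * u ^ 2 := by gcongr
        _ ≤ u ^ 3 + v ^ 3 := by nlinarith [pow_nonneg hv 3]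
  linarith

lemma abs_resid_cube_mul_le (H : Regular ψ B D p b h K c ρ C c') (i : Fin N) :
    |resid ψ D b i| ^ 3 * ‖(D i).1‖ ^ 3 ≤ h i := by
  have h1 : (|resid ψ D b i| ^ 3) ^ 2 ≤ h i := by
    rw [← pow_mul, mul_comm 3 2, pow_mul, sq_abs, ← pow_mul]; exact H.resid_le i
  have h2 : (‖(D i).1‖ ^ 3) ^ 2 ≤ h i := by rw [← pow_mul]; exact H.norm_le i
  nlinarith [sq_nonneg (|resid ψ D b i| ^ 3 - ‖(D i).1‖ ^ 3)]

/-- Of the two factors `N⁻¹`, one joins `p⁻¹` to give `C / r` and the other averages `g`. -/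
lemma sum_weight_le (H : Regular ψ B D p b h K c ρ C c') (hr : 0 < expSize p) (hC : 0 ≤ C)
    {g : Fin N → ℝ} (hg0 : ∀ i, 0 ≤ g i) (hg : ∀ i, g i ≤ 1 + 2 * h i) :
    ∑ i, ((p i : ℝ)⁻¹ - 1) * ((N : ℝ)⁻¹ ^ 2 * g i) ≤ C / expSize p * (1 + 2 * K) := by
  have hN : (0 : ℝ) < N := by exact_mod_cast size_pos hr
  calc _ ≤ ∑ i, C / expSize p * ((N : ℝ)⁻¹ * (1 + 2 * h i)) := by
        refine Finset.sum_le_sum fun i _ => ?_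
        calc ((p i : ℝ)⁻¹ - 1) * ((N : ℝ)⁻¹ ^ 2 * g i)
            ≤ (p i : ℝ)⁻¹ * ((N : ℝ)⁻¹ ^ 2 * g i) :=
              mul_le_mul_of_nonneg_right (by linarith) (mul_nonneg (by positivity) (hg0 i))
          _ = ((N : ℝ) * p i)⁻¹ * ((N : ℝ)⁻¹ * g i) := by rw [mul_inv]; ring
          _ ≤ _ := mul_le_mul (H.weight i) (by gcongr; exact hg i)
              (mul_nonneg (by positivity) (hg0 i)) (by positivity)
    _ = C / expSize p * ((N : ℝ)⁻¹ * (N + 2 * ∑ i, h i)) := by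
        rw [← Finset.mul_sum, ← Finset.mul_sum, Finset.sum_add_distrib, ← Finset.mul_sum]
        simp
    _ ≤ C / expSize p * ((N : ℝ)⁻¹ * (N + 2 * (K * N))) := by gcongr; exact H.sum_le
    _ = _ := by field_simp

/-- Subtracting the full score, which is zero at `b`, centres the weights. -/
lemma smul_subsampleScore_eq (H : Regular ψ B D p b h K c ρ C c') (δ : Fin N → Bool) :
    (N : ℝ)⁻¹ • subsampleScore ψ D p δ b
      = ∑ i, (wt p δ i - 1) • ((N : ℝ)⁻¹ * resid ψ D b i) • (D i).1 := by
  have h1 := H.score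
  rw [fullScore] at h1
  rw [← sub_zero (subsampleScore ψ D p δ b), ← h1, subsampleScore_eq, ← Finset.sum_sub_distrib,
    Finset.smul_sum]
  refine Finset.sum_congr rfl fun i _ => ?_
  rw [← sub_smul, smul_smul, smul_smul]
  congr 1; ring

lemma integral_score_le (H : Regular ψ B D p b h K c ρ C c') (hr : 0 < expSize p) (hC : 0 ≤ C) :
    ∫ δ, ‖(N : ℝ)⁻¹ • subsampleScore ψ D p δ b‖ ^ 2 ∂(subsampleLaw p)
      ≤ C / expSize p * (1 + 2 * K) := by
  simp_rw [H.smul_subsampleScore_eq]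
  rw [integral_norm_sum_wt_sub_one_sq H.prob_pos]
  refine le_trans (le_of_eq ?_) (H.sum_weight_le hr hC (fun i => by positivity) H.resid_sq_mul_le)
  refine Finset.sum_congr rfl fun i _ => ?_
  rw [norm_smul, mul_pow, Real.norm_eq_abs, sq_abs]; ring

lemma integral_hessDev_le (H : Regular ψ B D p b h K c ρ C c') (hr : 0 < expSize p) (hC : 0 ≤ C) :
    ∫ δ, hessDev ψ D p b δ ∂(subsampleLaw p) ≤ C / expSize p * (1 + 2 * K) := by
  simp only [hessDev]
  rw [integral_finsetSum _ fun i _ => integrable_subsampleLaw p _]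
  simp_rw [integral_norm_sum_wt_sub_one_sq H.prob_pos]
  rw [Finset.sum_comm]
  refine le_trans (le_of_eq ?_) (H.sum_weight_le hr hC (fun i => by positivity) H.deriv_sq_mul_le)
  refine Finset.sum_congr rfl fun i _ => ?_
  rw [← Finset.mul_sum]
  congr 1
  have hx : ∑ k, ⟪(D i).1, EuclideanSpace.basisFun (Fin d) ℝ k⟫ ^ 2 = ‖(D i).1‖ ^ 2 := by
    rw [EuclideanSpace.norm_sq_eq]; simp [PiLp.inner_apply]
  calc _ = ∑ k, (N : ℝ)⁻¹ ^ 2 * deriv ψ ⟪b, (D i).1⟫ ^ 2 * ‖(D i).1‖ ^ 2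
        * ⟪(D i).1, EuclideanSpace.basisFun (Fin d) ℝ k⟫ ^ 2 := by
        refine Finset.sum_congr rfl fun k _ => ?_
        rw [norm_smul, mul_pow, Real.norm_eq_abs, sq_abs]; ring
    _ = _ := by rw [← Finset.mul_sum, hx]; ring

lemma integral_lip_le (H : Regular ψ B D p b h K c ρ C c') (hr : 0 < expSize p) :
    ∫ δ, (N : ℝ)⁻¹ * ∑ i, wt p δ i * h i ∂(subsampleLaw p) ≤ K := by
  have hN : (0 : ℝ) < N := by exact_mod_cast size_pos hr
  rw [integral_const_mul, integral_finsetSum _ fun i _ => integrable_subsampleLaw p _]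
  simp_rw [integral_mul_const, integral_wt H.prob_pos, one_mul]
  rw [inv_mul_le_iff₀ hN, mul_comm]
  exact H.sum_le

/-- The selections for which the estimating function is well behaved. -/
def goodSet (ψ : ℝ → ℝ) (D : Data d N) (p : Fin N → I) (b : Vec d) (h : Fin N → ℝ) (T : ℝ) :
    Set (Fin N → Bool) :=
  {δ | ‖(N : ℝ)⁻¹ • subsampleScore ψ D p δ b‖ ^ 2 ≤ T / expSize p ∧
    hessDev ψ D p b δ ≤ T / expSize p ∧ (N : ℝ)⁻¹ * ∑ i, wt p δ i * h i ≤ T}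

lemma real_compl_goodSet_le (H : Regular ψ B D p b h K c ρ C c') (hr : 0 < expSize p)
    (hC : 0 ≤ C) {T : ℝ} (hT : 0 < T) :
    (subsampleLaw p).real (goodSet ψ D p b h T)ᶜ ≤ (2 * (C * (1 + 2 * K)) + K) / T := by
  have hTr : 0 < T / expSize p := by positivity
  have h1 := subsampleLaw_real_lt_le p (fun δ => by positivity) hTr (H.integral_score_le hr hC)
  have h2 := subsampleLaw_real_lt_le p (f := hessDev ψ D p b)
    (fun δ => Finset.sum_nonneg fun k _ => by positivity) hTr (H.integral_hessDev_le hr hC)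
  have h3 := subsampleLaw_real_lt_le p
    (fun δ => mul_nonneg (by positivity) (Finset.sum_nonneg fun i _ =>
      mul_nonneg (wt_nonneg δ i) (H.nonneg i))) hT (H.integral_lip_le hr)
  have hsub : (goodSet ψ D p b h T)ᶜ ⊆
      ({δ | T / expSize p < ‖(N : ℝ)⁻¹ • subsampleScore ψ D p δ b‖ ^ 2} ∪
        {δ | T / expSize p < hessDev ψ D p b δ}) ∪
        {δ | T < (N : ℝ)⁻¹ * ∑ i, wt p δ i * h i} := by
    intro δ hδ
    simp only [goodSet, Set.mem_compl_iff, Set.mem_ofPred_eq, not_and_or, not_le] at hδ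
    rcases hδ with hδ | hδ | hδ
    · exact Or.inl (Or.inl hδ)
    · exact Or.inl (Or.inr hδ)
    · exact Or.inr hδ
  refine (measureReal_mono hsub).trans ((measureReal_union_le _ _).trans
    ((add_le_add (measureReal_union_le _ _) le_rfl).trans
      ((add_le_add (add_le_add h1 h2) h3).trans_eq ?_)))
  field_simp
  ring

/-- On the good selections the subsample estimator is the unique root of the weighted estimating
equation, and its standardized error is linear up to a remainder of order `r^{-1/2}`. -/
lemma norm_error_sub_le (H : Regular ψ B D p b h K c ρ C c') (hψ : ContDiff ℝ 2 ψ)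
    (hψ_pos : ∀ t, 0 < deriv ψ t) (hr : 0 < expSize p) (hc : 0 < c) (hρ : 0 < ρ)
    {T : ℝ} (hT : 0 < T) (hq : √(T / expSize p) ≤ c / 4)
    (hqs : √(T / expSize p) < c * min ρ (c / (4 * T)) / 4)
    {G : Matrix (Fin d) (Fin d) ℝ} {a : ℝ} (ha : 0 ≤ a) (hG : ∀ v : Vec d, ‖op G v‖ ≤ a * ‖v‖)
    {δ : Fin N → Bool} (hδ : δ ∈ goodSet ψ D p b h T) {β : Vec d}
    (hβ : (∃ β ∈ paramBall d B, subsampleScore ψ D p δ β = 0) → subsampleScore ψ D p δ β = 0) :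
    ‖op (G * sigmaPsi ψ D b) (β - b) - op G ((N : ℝ)⁻¹ • subsampleScore ψ D p δ b)‖
      ≤ a * (T / expSize p * (2 / c + 4 * T / c ^ 2)) := by
  obtain ⟨hδ₀, hδ₁, hδ₂⟩ := hδ
  have hN : (0 : ℝ) < N := by exact_mod_cast size_pos hr
  set q := √(T / expSize p) with hq_def
  have hq0 : 0 ≤ q := Real.sqrt_nonneg _
  have hq2 : q ^ 2 = T / expSize p := Real.sq_sqrt (by positivity)
  -- The first bound keeps the ball of radius `s` in the parameter space; the second keeps the
  -- curvature loss `m * s` below `c / 4`.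
  set s := min ρ (c / (4 * T)) with hs_def
  have hs : 0 < s := lt_min hρ (by positivity)
  set m := (N : ℝ)⁻¹ * ∑ i, wt p δ i * h i
  have hm : 0 ≤ m := mul_nonneg (by positivity) (Finset.sum_nonneg fun i _ =>
      mul_nonneg (wt_nonneg δ i) (H.nonneg i))
  have hms : m * s ≤ c / 4 := by
    calc m * s ≤ T * (c / (4 * T)) := mul_le_mul hδ₂ (min_le_right _ _) hs.le hT.le
      _ = c / 4 := by field_simp
  let Q : Vec d → Vec d := fun β => (N : ℝ)⁻¹ • subsampleScore ψ D p δ β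
  have hQb : ‖Q b‖ ≤ q := Real.le_sqrt_of_sq_le hδ₀
  have hS := mul_norm_sq_le_inner_op H.eig
  have hH (v : Vec d) :
      ‖subsampleHess ψ D p δ b v - op (sigmaPsi ψ D b) v‖ ≤ q * ‖v‖ :=
    (norm_subsampleHess_sub_le δ b v).trans
      (mul_le_mul_of_nonneg_right (Real.sqrt_le_sqrt hδ₁) (norm_nonneg _))
  have hlin (β : Vec d) (hβs : ‖β - b‖ ≤ s) :
      ‖Q β - Q b + subsampleHess ψ D p δ b (β - b)‖ ≤ m * ‖β - b‖ ^ 2 :=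
    norm_subsampleScore_linearization_le (hψ.differentiable (by norm_num)) H.nonneg
      (fun i β hβ => H.lip i β (H.ball β hβ)) (hβs.trans (min_le_left _ _))
  obtain ⟨F, hF⟩ := exists_hasFDerivAt_subsampleScore (D := D) (p := p) hψ.continuous δ (N : ℝ)⁻¹
  obtain ⟨β₀, hβ₀, hβ₀Q⟩ := exists_zero_of_inward (q := Q) hF b hs fun β hβs => by
    have h1 := inner_le_of_linearization hS hH hq hm hms hβs.le (hlin β hβs.le)
    rw [hβs] at h1
    -- On the sphere the noise costs at most `c s² / 4`, less than the surviving drift `c s² / 2`.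
    have h2 : ‖Q b‖ * s ≤ c * s / 4 * s := by gcongr; exact hQb.trans hqs.le
    nlinarith [mul_pos hc (mul_pos hs hs)]
  have hroot {β : Vec d} (h0 : Q β = 0) : subsampleScore ψ D p δ β = 0 :=
    (smul_eq_zero.1 h0).resolve_left (inv_ne_zero hN.ne')
  have hβ_root := hβ ⟨β₀, H.ball β₀ (hβ₀.le.trans (min_le_left _ _)), hroot hβ₀Q⟩
  -- The chosen root `β` is not assumed to lie in the parameter space, so uniqueness is needed on
  -- all of `ℝᵈ`.
  have hβeq : β = β₀ := by
    refine subsampleScore_root_unique (strictMono_of_deriv_pos hψ_pos) hβ_root (hroot hβ₀Q)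
      fun v hv => ?_
    -- A direction invisible to the sample kills the sampled Hessian, yet that Hessian is within `c
    -- / 4` of a matrix bounded below by `c`.
    have hHv : subsampleHess ψ D p δ b v = 0 := by
      rw [subsampleHess, Finset.sum_eq_zero, smul_zero]
      intro i _
      rcases hv i with hi | hi <;> simp [hi]
    have h1 := hH v
    rw [hHv, zero_sub, norm_neg] at h1
    have h2 : c * ‖v‖ ^ 2 ≤ c / 4 * ‖v‖ ^ 2 := by
      calc _ ≤ _ := hS v
        _ ≤ ‖v‖ * ‖op (sigmaPsi ψ D b) v‖ := real_inner_le_norm _ _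
        _ ≤ ‖v‖ * (c / 4 * ‖v‖) := by gcongr; exact h1.trans (by gcongr)
        _ = _ := by ring
    have h3 : ‖v‖ ^ 2 ≤ 0 := by nlinarith [sq_nonneg ‖v‖]
    simpa using le_antisymm h3 (sq_nonneg _)
  subst hβeq
  have hΔ : ‖β - b‖ ≤ 2 / c * q :=
    (norm_sub_le_of_root hc hS hH hq hm hms hβ₀.le (hlin β hβ₀.le) hβ₀Q).trans (by gcongr)
  have hrem := norm_sub_linear_le_of_root hH (hlin β hβ₀.le) hβ₀Q
  have heq : op (G * sigmaPsi ψ D b) (β - b) - op G ((N : ℝ)⁻¹ • subsampleScore ψ D p δ b)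
      = - op G (Q b - op (sigmaPsi ψ D b) (β - b)) := by
    have : op (G * sigmaPsi ψ D b) = op G * op (sigmaPsi ψ D b) := map_mul _ _ _
    rw [this, mul_apply_eq_comp, map_sub (op G)]; abel
  rw [heq, norm_neg]
  refine (hG _).trans (mul_le_mul_of_nonneg_left (hrem.trans ?_) ha)
  calc q * ‖β - b‖ + m * ‖β - b‖ ^ 2 ≤ q * (2 / c * q) + T * (2 / c * q) ^ 2 := by gcongr
    _ = q ^ 2 * (2 / c + 4 * T / c ^ 2) := by field_simp; ring
    _ = _ := by rw [hq2]

/-- Quantitative central limit theorem, on the level of characteristic functions. -/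
lemma norm_charFun_error_sub_le (H : Regular ψ B D p b h K c ρ C c') (hψ : ContDiff ℝ 2 ψ)
    (hψ_pos : ∀ t, 0 < deriv ψ t) (hr : 0 < expSize p) (hc : 0 < c) (hρ : 0 < ρ) (hC : 0 ≤ C)
    (hc' : 0 < c') {T : ℝ} (hT : 0 < T) (hq : √(T / expSize p) ≤ c / 4)
    (hqs : √(T / expSize p) < c * min ρ (c / (4 * T)) / 4) {bt : (Fin N → Bool) → Vec d}
    (hbt : ∀ δ, (∃ β ∈ paramBall d B, subsampleScore ψ D p δ β = 0) →
      subsampleScore ψ D p δ (bt δ) = 0) (t : Vec d) :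
    ‖∫ δ, Complex.exp ((⟪op (invSqrt (varV ψ D p b)) (bt δ - b), t⟫ : ℝ) * Complex.I)
        ∂(subsampleLaw p) - (Real.exp (-(‖t‖ ^ 2 / 2)) : ℂ)‖
      ≤ 2 * ((2 * (C * (1 + 2 * K)) + K) / T)
        + (√c')⁻¹ * (T * (2 / c + 4 * T / c ^ 2)) * ‖t‖ * (√(expSize p))⁻¹
        + (4 + ‖t‖) * (C ^ 2 * K * ((√c')⁻¹ * ‖t‖) ^ 3) * (√(expSize p))⁻¹ := by
  have hN : (0 : ℝ) < N := by exact_mod_cast size_pos hr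
  set r := expSize p with hr_def
  have hW : (varC ψ D p b).PosDef := by
    have := (posDef_of_sub_smul_one hc' H.nondeg).smul (inv_pos.2 hr)
    rwa [smul_smul, inv_mul_cancel₀ hr.ne', one_smul] at this
  obtain ⟨G, hGS, hGW⟩ := exists_invSqrt_eq_mul (posDef_of_sub_smul_one hc H.eig) hW
  have hsr : 0 < √r := Real.sqrt_pos.2 hr
  have hsr2 : √r ^ 2 = r := Real.sq_sqrt hr.le
  have hsc : 0 < √c' := Real.sqrt_pos.2 hc'
  set a := √r * (√c')⁻¹ with ha_def
  have ha : 0 ≤ a := by positivity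
  have hGt (t : Vec d) : ‖op G.transpose t‖ ≤ a * ‖t‖ := by
    refine (abs_le_of_sq_le_sq' ((norm_op_transpose_sq_le hGW hc' H.nondeg t).trans_eq ?_)
      (by positivity)).2
    rw [mul_pow, ha_def, mul_pow, hsr2, inv_pow, Real.sq_sqrt hc'.le]; rfl
  have hGv := norm_op_le_of_transpose hGt
  have hstep1 := norm_integral_exp_sub_le p
    (fun δ => ⟪op (invSqrt (varV ψ D p b)) (bt δ - b), t⟫)
    (fun δ => ⟪op G ((N : ℝ)⁻¹ • subsampleScore ψ D p δ b), t⟫) (goodSet ψ D p b h T)ᶜ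
    (η := (√c')⁻¹ * (T * (2 / c + 4 * T / c ^ 2)) * ‖t‖ * (√r)⁻¹) (by positivity)
    (fun δ hδ => by
      rw [← inner_sub_left, varV, hGS]
      refine (abs_real_inner_le_norm _ _).trans ?_
      have := H.norm_error_sub_le hψ hψ_pos hr hc hρ hT hq hqs ha hGv (not_not.1 hδ) (hbt δ)
      refine (mul_le_mul_of_nonneg_right this (norm_nonneg t)).trans_eq ?_
      rw [ha_def, ← hr_def, show T / r = T / √r ^ 2 by rw [hsr2]]
      field_simp)
  set u := op G.transpose t
  let α : Fin N → ℝ := fun i => (N : ℝ)⁻¹ * resid ψ D b i * ⟪(D i).1, u⟫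
  have hα (δ : Fin N → Bool) : ⟪op G ((N : ℝ)⁻¹ • subsampleScore ψ D p δ b), t⟫
      = ∑ i, (wt p δ i - 1) * α i := by
    rw [inner_op_left, H.smul_subsampleScore_eq, sum_inner]
    refine Finset.sum_congr rfl fun i _ => ?_
    rw [real_inner_smul_left, real_inner_smul_left]
  have hvar : ∑ i, ((p i : ℝ)⁻¹ - 1) * α i ^ 2 = ‖t‖ ^ 2 := by
    rw [← inner_op_varC, inner_op_left, Matrix.transpose_transpose, ← mul_apply_eq_comp,
      ← mul_apply_eq_comp, ← map_mul, ← map_mul, hGW, map_one,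
      one_apply_eq_self, real_inner_self_eq_norm_sq]
  have hstep2 := norm_integral_exp_sum_wt_sub_le H.prob_pos α (norm_nonneg t) hvar
  -- Orders in `r`: `(N p)⁻²` contributes `r⁻²` and `‖Gᵀ t‖³` contributes `r^{3/2}`, while `N⁻¹ ∑ h`
  -- is bounded by `K`.
  have hlyap : ∑ i, |α i| ^ 3 / (p i : ℝ) ^ 2 ≤ C ^ 2 * K * ((√c')⁻¹ * ‖t‖) ^ 3 * (√r)⁻¹ := by
    calc _ ≤ ∑ i, (C / r) ^ 2 * (N : ℝ)⁻¹ * (a * ‖t‖) ^ 3 * h i := by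
          refine Finset.sum_le_sum fun i _ => ?_
          have hpi : (0 : ℝ) < p i := H.prob_pos i
          have h1 : |⟪(D i).1, u⟫| ≤ ‖(D i).1‖ * (a * ‖t‖) :=
            (abs_real_inner_le_norm _ _).trans (by gcongr; exact hGt t)
          have h2 : |α i| ^ 3 ≤ (N : ℝ)⁻¹ ^ 3 * ((a * ‖t‖) ^ 3 * h i) := by
            calc |α i| ^ 3 = (N : ℝ)⁻¹ ^ 3 * |resid ψ D b i| ^ 3 * |⟪(D i).1, u⟫| ^ 3 := by
                  simp only [α, abs_mul, mul_pow, abs_inv, Nat.abs_cast]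
              _ ≤ (N : ℝ)⁻¹ ^ 3 * |resid ψ D b i| ^ 3 * (‖(D i).1‖ * (a * ‖t‖)) ^ 3 := by gcongr
              _ = (N : ℝ)⁻¹ ^ 3 * ((a * ‖t‖) ^ 3 * (|resid ψ D b i| ^ 3 * ‖(D i).1‖ ^ 3)) := by
                  ring
              _ ≤ _ := by gcongr; exact H.abs_resid_cube_mul_le i
          have hi := H.nonneg i
          calc |α i| ^ 3 / (p i : ℝ) ^ 2
              ≤ (N : ℝ)⁻¹ ^ 3 * ((a * ‖t‖) ^ 3 * h i) / (p i : ℝ) ^ 2 := by gcongr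
            _ = ((N : ℝ) * p i)⁻¹ ^ 2 * ((N : ℝ)⁻¹ * (a * ‖t‖) ^ 3 * h i) := by
                field_simp
            _ ≤ (C / r) ^ 2 * ((N : ℝ)⁻¹ * (a * ‖t‖) ^ 3 * h i) := by
                gcongr; exact H.weight i
            _ = _ := by ring
      _ = (C / r) ^ 2 * (N : ℝ)⁻¹ * (a * ‖t‖) ^ 3 * ∑ i, h i := by rw [← Finset.mul_sum]
      _ ≤ (C / r) ^ 2 * (N : ℝ)⁻¹ * (a * ‖t‖) ^ 3 * (K * N) := by gcongr; exact H.sum_le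
      _ = _ := by rw [ha_def, show C / r = C / √r ^ 2 by rw [hsr2]]; field_simp
  simp_rw [← hα] at hstep2
  have hbad := H.real_compl_goodSet_le hr hC hT
  calc _ ≤ _ := norm_sub_le_norm_sub_add_norm_sub _ _ _
    _ ≤ _ := add_le_add hstep1 (hstep2.trans (mul_le_mul_of_nonneg_left hlyap (by positivity)))
    _ ≤ _ := by rw [mul_assoc (4 + ‖t‖)]; linarith

end Regular

/-! ### Uniform convergence over regular data sets. -/

/-- The conditional law of the standardized error of the subsample estimator is close to the
standard normal law, uniformly over regular full data sets with large expected subsample size. -/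
theorem exists_expSize_forall_regular {d : ℕ} {ψ : ℝ → ℝ} (hψ : ContDiff ℝ 2 ψ)
    (hψ_pos : ∀ t, 0 < deriv ψ t) (B : ℝ) {K c ρ C c' : ℝ} (hc : 0 < c) (hρ : 0 < ρ) (hC : 0 ≤ C)
    (hc' : 0 < c') (f : Vec d →ᵇ ℝ) {ε : ℝ} (hε : 0 < ε) :
    ∃ R : ℝ, ∀ (N : ℕ) (D : Data d N) (p : Fin N → I) (b : Vec d) (h : Fin N → ℝ)
      (bt : (Fin N → Bool) → Vec d), Regular ψ B D p b h K c ρ C c' → R ≤ expSize p →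
      (∀ δ, (∃ β ∈ paramBall d B, subsampleScore ψ D p δ β = 0) →
        subsampleScore ψ D p δ (bt δ) = 0) →
      |∫ δ, f (op (invSqrt (varV ψ D p b)) (bt δ - b)) ∂(subsampleLaw p)
        - ∫ z, f z ∂(stdGaussian (Vec d))| < ε := by
  by_contra hcon
  push Not at hcon
  -- A failure for every threshold yields a sequence of regular data sets with `r → ∞`. Their sizes
  -- vary, but the error laws all live on `ℝᵈ`, where Lévy's theorem applies.
  choose N D p b h bt H hR hbt hfar using fun j : ℕ => hcon (j : ℝ)
  let e : (j : ℕ) → (Fin (N j) → Bool) → Vec d :=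
    fun j δ => op (invSqrt (varV ψ (D j) (p j) (b j))) (bt j δ - b j)
  have he (j : ℕ) : AEMeasurable (e j) (subsampleLaw (p j)) :=
    (measurable_of_countable _).aemeasurable
  let μ : ℕ → ProbabilityMeasure (Vec d) := fun j =>
    ⟨(subsampleLaw (p j)).map (e j), Measure.isProbabilityMeasure_map (he j)⟩
  let γ : ProbabilityMeasure (Vec d) := ⟨stdGaussian (Vec d), inferInstance⟩
  have hrtop : Tendsto (fun j => expSize (p j)) atTop atTop :=
    tendsto_atTop_mono hR tendsto_natCast_atTop_atTop
  have hsinv : Tendsto (fun j => (√(expSize (p j)))⁻¹) atTop (𝓝 0) :=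
    tendsto_inv_atTop_zero.comp (Real.tendsto_sqrt_atTop.comp hrtop)
  have hchar (t : Vec d) :
      Tendsto (fun j => charFun (μ j : Measure (Vec d)) t) atTop
        (𝓝 (charFun (γ : Measure (Vec d)) t)) := by
    have h1 (j : ℕ) : charFun (μ j : Measure (Vec d)) t
        = ∫ δ, Complex.exp ((⟪e j δ, t⟫ : ℝ) * Complex.I) ∂(subsampleLaw (p j)) := by
      rw [charFun_apply]
      exact integral_map (he j) (Continuous.aestronglyMeasurable (by fun_prop))
    have h2 : charFun (γ : Measure (Vec d)) t = (Real.exp (-(‖t‖ ^ 2 / 2)) : ℂ) := by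
      refine (charFun_stdGaussian t).trans ?_
      push_cast; rw [neg_div]
    rw [h2]
    simp_rw [h1]
    rw [tendsto_iff_norm_sub_tendsto_zero]
    refine tendsto_order.2 ⟨fun x hx => Eventually.of_forall fun j => hx.trans_le (norm_nonneg _),
      fun x hx => ?_⟩
    -- The Markov level `T` is fixed first, making the bad selections rare uniformly in `j`; the
    -- other terms then vanish as `r → ∞`.
    obtain ⟨T, hT, hTx⟩ : ∃ T : ℝ, 0 < T ∧ 2 * ((2 * (C * (1 + 2 * K)) + K) / T) < x := by
      have : Tendsto (fun T : ℝ => 2 * ((2 * (C * (1 + 2 * K)) + K) / T)) atTop (𝓝 (2 * 0)) :=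
        (tendsto_const_nhds.div_atTop tendsto_id).const_mul 2
      rw [mul_zero] at this
      exact ((eventually_gt_atTop 0).and (this.eventually_lt_const hx)).exists
    have hqt : Tendsto (fun j => √(T / expSize (p j))) atTop (𝓝 0) := by
      simpa [Function.comp_def] using (Real.continuous_sqrt.tendsto 0).comp
        ((tendsto_const_nhds (x := T)).div_atTop hrtop)
    have hlim := ((hsinv.const_mul ((√c')⁻¹ * (T * (2 / c + 4 * T / c ^ 2)) * ‖t‖)).const_add
      (2 * ((2 * (C * (1 + 2 * K)) + K) / T))).add
        (hsinv.const_mul ((4 + ‖t‖) * (C ^ 2 * K * ((√c')⁻¹ * ‖t‖) ^ 3)))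
    simp only [mul_zero, add_zero] at hlim
    have hs : 0 < c * min ρ (c / (4 * T)) / 4 := by
      have := lt_min hρ (show 0 < c / (4 * T) by positivity)
      positivity
    filter_upwards [hlim.eventually_lt_const hTx, hrtop.eventually_gt_atTop 0,
      hqt.eventually_lt_const (show 0 < c / 4 by positivity), hqt.eventually_lt_const hs]
      with j hj hrj hqj hqsj
    exact ((H j).norm_charFun_error_sub_le hψ hψ_pos hrj hc hρ hC hc' hT hqj.le hqsj
      (hbt j) t).trans_lt hj
  have hconv := ProbabilityMeasure.tendsto_of_tendsto_charFun hchar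
  rw [ProbabilityMeasure.tendsto_iff_forall_integral_tendsto] at hconv
  have hf := hconv f
  have hmap (j : ℕ) : ∫ z, f z ∂(μ j : Measure (Vec d)) = ∫ δ, f (e j δ) ∂(subsampleLaw (p j)) :=
    integral_map (he j) f.continuous.aestronglyMeasurable
  simp_rw [hmap] at hf
  obtain ⟨j, hj⟩ := ((Metric.tendsto_nhds.1 hf) ε hε).exists
  rw [Real.dist_eq] at hj
  exact absurd hj (not_lt.2 (hfar j))

/-! ### Closeness of the full-data root to the true parameter. -/

lemma convex_paramBall (d : ℕ) (B : ℝ) : Convex ℝ (paramBall d B) := by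
  intro x hx y hy a b ha hb hab
  simp only [paramBall, Set.mem_ofPred_eq] at hx hy ⊢
  calc ∑ j, |(a • x + b • y) j| ≤ ∑ j, (a * |x j| + b * |y j|) := by
        refine Finset.sum_le_sum fun j _ => ?_
        simp only [PiLp.add_apply, PiLp.smul_apply, smul_eq_mul]
        refine (abs_add_le _ _).trans_eq ?_
        rw [abs_mul, abs_mul, abs_of_nonneg ha, abs_of_nonneg hb]
    _ = a * ∑ j, |x j| + b * ∑ j, |y j| := by
        rw [Finset.sum_add_distrib, Finset.mul_sum, Finset.mul_sum]
    _ ≤ a * B + b * B := by gcongr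
    _ = B := by rw [← add_mul, hab, one_mul]

/-- Under a uniform lower bound on the information, a root of the estimating equation is close to
any parameter at which the estimating function is small. -/
lemma mul_norm_sub_le_of_fullScore {d N : ℕ} {ψ : ℝ → ℝ} (hψ : Differentiable ℝ ψ) {B : ℝ}
    {D : Data d N} {b β : Vec d} {c : ℝ} (h0 : fullScore ψ D b = 0) (hb : b ∈ paramBall d B)
    (hβ : β ∈ paramBall d B)
    (heig : ∀ β ∈ paramBall d B,
      (sigmaPsi ψ D β - c • (1 : Matrix (Fin d) (Fin d) ℝ)).PosSemidef) :
    c * ‖b - β‖ ≤ ‖(N : ℝ)⁻¹ • fullScore ψ D β‖ := by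
  set v := β - b with hv
  have hd (t : ℝ) : HasDerivAt
      (fun t : ℝ => (N : ℝ)⁻¹ * ∑ i, resid ψ D (b + t • v) i * ⟪(D i).1, v⟫)
      (-⟪v, op (sigmaPsi ψ D (b + t • v)) v⟫) t := by
    have hterm (i : Fin N) : HasDerivAt (fun t : ℝ => resid ψ D (b + t • v) i * ⟪(D i).1, v⟫)
        (-(deriv ψ ⟪b + t • v, (D i).1⟫ * ⟪(D i).1, v⟫) * ⟪(D i).1, v⟫) t := by
      have h1 : HasDerivAt (fun t : ℝ => ⟪b + t • v, (D i).1⟫) ⟪(D i).1, v⟫ t := by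
        simp only [inner_add_left, real_inner_smul_left]
        rw [real_inner_comm v (D i).1]
        simpa using ((hasDerivAt_id t).mul_const ⟪v, (D i).1⟫).const_add ⟪b, (D i).1⟫
      exact (((hψ _).hasDerivAt.comp t h1).const_sub (D i).2).mul_const _
    refine ((HasDerivAt.fun_sum fun i _ => hterm i).const_mul (N : ℝ)⁻¹).congr_deriv ?_
    rw [op_sigmaPsi, real_inner_smul_right, inner_sum, ← mul_neg, ← Finset.sum_neg_distrib]
    congr 1
    refine Finset.sum_congr rfl fun i _ => ?_
    rw [real_inner_smul_right, real_inner_comm (D i).1 v]; ring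
  -- The mean value theorem is applied to the score's component along `v`, on a segment that stays
  -- in the parameter space by convexity.
  obtain ⟨t, ht, hslope⟩ := exists_hasDerivAt_eq_slope _ _ zero_lt_one
    (fun t _ => (hd t).continuousAt.continuousWithinAt) fun t _ => hd t
  have hmem : b + t • v ∈ paramBall d B :=
    (convex_paramBall d B).add_smul_sub_mem hb hβ (Set.Ioo_subset_Icc_self ht)
  have hscore (γ : Vec d) : (N : ℝ)⁻¹ * ∑ i, resid ψ D γ i * ⟪(D i).1, v⟫
      = ⟪(N : ℝ)⁻¹ • fullScore ψ D γ, v⟫ := by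
    rw [fullScore, real_inner_smul_left, sum_inner]
    simp only [real_inner_smul_left]
  have hquad := mul_norm_sq_le_inner_op (heig _ hmem) v
  rw [hscore, hscore] at hslope
  simp only [zero_smul, add_zero, one_smul, h0, smul_zero, inner_zero_left, sub_zero, div_one]
    at hslope
  rw [hv, add_sub_cancel, ← hv] at hslope
  have h2 := neg_le_of_abs_le (abs_real_inner_le_norm ((N : ℝ)⁻¹ • fullScore ψ D β) v)
  rw [norm_sub_rev b β, ← hv]
  rcases (norm_nonneg v).eq_or_lt with hz | hz
  · rw [← hz, mul_zero]; positivity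
  · refine le_of_mul_le_mul_right ?_ hz
    nlinarith

/-! ### Integrable envelope and the criterion for regularity. -/

/-- An integrable envelope for the covariates, the residuals, the derivatives of the mean function
and the Lipschitz constants. -/
noncomputable def envelope {d : ℕ} (ψ : ℝ → ℝ) (B : ℝ) (m₂ : Vec d → ℝ) (z : Vec d × ℝ) : ℝ≥0∞ :=
  ENNReal.ofReal (1 + ‖z.1‖ ^ 9) + 32 * (ENNReal.ofReal (|z.2| ^ 6)
    + ⨆ β ∈ paramBall d B, ENNReal.ofReal (ψ ⟪β, z.1⟫ ^ 6))
    + (⨆ β ∈ paramBall d B, ENNReal.ofReal (deriv ψ ⟪β, z.1⟫ ^ 6)) + ENNReal.ofReal |m₂ z.1|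

section Envelope

variable {d : ℕ} {ψ : ℝ → ℝ} {B : ℝ} {m₂ : Vec d → ℝ}

/-- An uncountable supremum of continuous functions is lower semicontinuous, hence measurable. -/
lemma measurable_iSup_paramBall {g : ℝ → ℝ} (hg : Continuous g) :
    Measurable fun x : Vec d => ⨆ β ∈ paramBall d B, ENNReal.ofReal (g ⟪β, x⟫ ^ 6) :=
  LowerSemicontinuous.measurable <| lowerSemicontinuous_biSup fun β _ =>
    (ENNReal.continuous_ofReal.comp ((hg.comp (by fun_prop)).pow 6)).lowerSemicontinuous

lemma measurable_envelope (hψ : ContDiff ℝ 2 ψ) (hm₂ : Measurable m₂) :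
    Measurable (envelope ψ B m₂) := by
  have h1 : Measurable fun z : Vec d × ℝ => ⨆ β ∈ paramBall d B,
      ENNReal.ofReal (ψ ⟪β, z.1⟫ ^ 6) :=
    (measurable_iSup_paramBall hψ.continuous).comp measurable_fst
  have h2 : Measurable fun z : Vec d × ℝ => ⨆ β ∈ paramBall d B,
      ENNReal.ofReal (deriv ψ ⟪β, z.1⟫ ^ 6) :=
    (measurable_iSup_paramBall (hψ.continuous_deriv (by norm_num))).comp measurable_fst
  have h4 : Measurable fun z : Vec d × ℝ => |m₂ z.1| := (hm₂.comp measurable_fst).abs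
  unfold envelope
  exact (((by fun_prop : Measurable fun z : Vec d × ℝ => ENNReal.ofReal (1 + ‖z.1‖ ^ 9)).add
    (((by fun_prop : Measurable fun z : Vec d × ℝ => ENNReal.ofReal (|z.2| ^ 6)).add
      h1).const_mul 32)).add h2).add h4.ennreal_ofReal

lemma norm_pow_le_envelope (z : Vec d × ℝ) : ENNReal.ofReal (‖z.1‖ ^ 6) ≤ envelope ψ B m₂ z := by
  refine le_trans (ENNReal.ofReal_le_ofReal ?_)
    (le_add_right (le_add_right (le_add_right le_rfl)))
  rcases le_total ‖z.1‖ 1 with h | h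
  · linarith [pow_le_one₀ (n := 6) (norm_nonneg z.1) h, pow_nonneg (norm_nonneg z.1) 9]
  · linarith [pow_le_pow_right₀ h (show 6 ≤ 9 by norm_num)]

lemma resid_pow_le_envelope (z : Vec d × ℝ) {β : Vec d} (hβ : β ∈ paramBall d B) :
    ENNReal.ofReal ((z.2 - ψ ⟪β, z.1⟫) ^ 6) ≤ envelope ψ B m₂ z := by
  have h1 : (z.2 - ψ ⟪β, z.1⟫) ^ 6 ≤ 32 * (|z.2| ^ 6 + ψ ⟪β, z.1⟫ ^ 6) := by
    -- The constant `32 = 2 ^ 5` comes from `(a + b) ^ 6 ≤ 2 ^ 5 (a ^ 6 + b ^ 6)`.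
    have := Even.add_pow_le (n := 6) (by decide) (a := z.2) (b := -ψ ⟪β, z.1⟫)
    rw [← sub_eq_add_neg, Even.neg_pow (by decide)] at this
    rw [Even.pow_abs (by decide)]
    norm_num at this
    exact this
  have hψ6 : 0 ≤ ψ ⟪β, z.1⟫ ^ 6 := Even.pow_nonneg (by decide) _
  refine (ENNReal.ofReal_le_ofReal h1).trans ?_
  rw [ENNReal.ofReal_mul (by norm_num), ENNReal.ofReal_add (by positivity) hψ6]
  refine le_trans ?_ (le_add_right (le_add_right le_add_self))
  rw [ENNReal.ofReal_ofNat]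
  gcongr
  exact le_iSup₂ (f := fun β _ => ENNReal.ofReal (ψ ⟪β, z.1⟫ ^ 6)) β hβ

lemma deriv_pow_le_envelope (z : Vec d × ℝ) {β : Vec d} (hβ : β ∈ paramBall d B) :
    ENNReal.ofReal (deriv ψ ⟪β, z.1⟫ ^ 6) ≤ envelope ψ B m₂ z :=
  (le_iSup₂ (f := fun β _ => ENNReal.ofReal (deriv ψ ⟪β, z.1⟫ ^ 6)) β hβ).trans
    (le_add_right le_add_self)

lemma abs_le_envelope (z : Vec d × ℝ) : ENNReal.ofReal |m₂ z.1| ≤ envelope ψ B m₂ z :=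
  le_add_self

lemma lintegral_envelope_lt_top {Ω : Type*} [MeasurableSpace Ω] {P : Measure Ω}
    [IsProbabilityMeasure P] {X : Ω → Vec d} {Y : Ω → ℝ} (hX : Measurable X) (hY : Measurable Y)
    (hψ : ContDiff ℝ 2 ψ) (h_mom_x : Integrable (fun ω => ‖X ω‖ ^ 9) P)
    (h_mom_y : Integrable (fun ω => |Y ω| ^ 6) P)
    (h_mom_psi : ∫⁻ ω, ⨆ β ∈ paramBall d B, ENNReal.ofReal (ψ ⟪β, X ω⟫ ^ 6) ∂P < ∞)
    (h_mom_dpsi : ∫⁻ ω, ⨆ β ∈ paramBall d B, ENNReal.ofReal (deriv ψ ⟪β, X ω⟫ ^ 6) ∂P < ∞)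
    (hm₂_int : Integrable (fun ω => m₂ (X ω)) P) :
    ∫⁻ ω, envelope ψ B m₂ (X ω, Y ω) ∂P < ∞ := by
  have h1 : Measurable fun ω => ⨆ β ∈ paramBall d B, ENNReal.ofReal (ψ ⟪β, X ω⟫ ^ 6) :=
    (measurable_iSup_paramBall hψ.continuous).comp hX
  have h2 : Measurable fun ω => ⨆ β ∈ paramBall d B, ENNReal.ofReal (deriv ψ ⟪β, X ω⟫ ^ 6) :=
    (measurable_iSup_paramBall (hψ.continuous_deriv (by norm_num))).comp hX
  have hx : Measurable fun ω => ENNReal.ofReal (1 + ‖X ω‖ ^ 9) := by fun_prop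
  have hy : Measurable fun ω => ENNReal.ofReal (|Y ω| ^ 6) := by fun_prop
  have fin {f : Ω → ℝ} (hf : Integrable f P) : ∫⁻ ω, ENNReal.ofReal (f ω) ∂P < ∞ :=
    hf.lintegral_lt_top
  simp only [envelope]
  have hy' : Measurable fun ω => ENNReal.ofReal (|Y ω| ^ 6)
      + ⨆ β ∈ paramBall d B, ENNReal.ofReal (ψ ⟪β, X ω⟫ ^ 6) := hy.add h1
  have hx' : Measurable fun ω => ENNReal.ofReal (1 + ‖X ω‖ ^ 9) + 32 * (ENNReal.ofReal (|Y ω| ^ 6)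
      + ⨆ β ∈ paramBall d B, ENNReal.ofReal (ψ ⟪β, X ω⟫ ^ 6)) := hx.add (hy'.const_mul 32)
  rw [lintegral_add_left (f := fun ω => ENNReal.ofReal (1 + ‖X ω‖ ^ 9)
      + 32 * (ENNReal.ofReal (|Y ω| ^ 6) + ⨆ β ∈ paramBall d B, ENNReal.ofReal (ψ ⟪β, X ω⟫ ^ 6))
      + ⨆ β ∈ paramBall d B, ENNReal.ofReal (deriv ψ ⟪β, X ω⟫ ^ 6)) (hx'.add h2),
    lintegral_add_left hx', lintegral_add_left hx, lintegral_const_mul 32 hy',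
    lintegral_add_left hy]
  refine ENNReal.add_lt_top.2 ⟨ENNReal.add_lt_top.2 ⟨ENNReal.add_lt_top.2 ⟨?_, ?_⟩, h_mom_dpsi⟩, ?_⟩
  · exact fin ((integrable_const 1).add h_mom_x)
  · exact ENNReal.mul_lt_top (by norm_num) (ENNReal.add_lt_top.2 ⟨fin h_mom_y, h_mom_psi⟩)
  · exact fin hm₂_int.abs

end Envelope

lemma regular_of_bounds {d N : ℕ} {ψ : ℝ → ℝ} (hψ : ContDiff ℝ 2 ψ) {B : ℝ} {m₂ : Vec d → ℝ}
    {D : Data d N} {p : Fin N → I} {b βt : Vec d} {K c ρ C c' : ℝ} (hc : 0 < c) (hρ : 0 < ρ)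
    (hK : 0 ≤ K) (hp : ∀ i, 0 < p i) (hscore : fullScore ψ D b = 0) (hb : b ∈ paramBall d B)
    (heig : ∀ β ∈ paramBall d B,
      (sigmaPsi ψ D β - c • (1 : Matrix (Fin d) (Fin d) ℝ)).PosSemidef)
    (hball : ∀ β : Vec d, ‖β - βt‖ ≤ 2 * ρ → β ∈ paramBall d B)
    (hsmall : ‖(N : ℝ)⁻¹ • fullScore ψ D βt‖ ≤ c * ρ)
    (henv : ∑ i, envelope ψ B m₂ (D i) ≤ ENNReal.ofReal (K * N))
    (hlip : ∀ i, ∀ β₁ ∈ paramBall d B, ∀ β₂ ∈ paramBall d B,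
      ‖op (deriv ψ ⟪β₁, (D i).1⟫ • outer (D i).1 - deriv ψ ⟪β₂, (D i).1⟫ • outer (D i).1)‖
        ≤ m₂ (D i).1 * ‖β₁ - β₂‖)
    (hr : 0 < expSize p) (hwt : |(⨆ i, ((N : ℝ) * p i)⁻¹) * expSize p| ≤ C)
    (hnd : (expSize p • varC ψ D p b - c' • (1 : Matrix (Fin d) (Fin d) ℝ)).PosSemidef) :
    Regular ψ B D p b (fun i => (envelope ψ B m₂ (D i)).toReal) K c ρ C c' := by
  have hfin (i : Fin N) : envelope ψ B m₂ (D i) ≠ ∞ := ne_top_of_le_ne_top ENNReal.ofReal_ne_top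
    ((Finset.single_le_sum (fun i _ => zero_le) (Finset.mem_univ i)).trans henv)
  have key {i : Fin N} {x : ℝ} (hx : ENNReal.ofReal x ≤ envelope ψ B m₂ (D i)) :
      x ≤ (envelope ψ B m₂ (D i)).toReal := (ENNReal.ofReal_le_iff_le_toReal (hfin i)).1 hx
  -- Half of the margin `2 * ρ` around `βt` is spent here; the other half is the ball around `b`.
  have hclose : ‖b - βt‖ ≤ ρ := by
    have := mul_norm_sub_le_of_fullScore (hψ.differentiable (by norm_num)) hscore hb
      (hball βt (by simpa using by positivity)) heig
    exact le_of_mul_le_mul_left (this.trans hsmall) hc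
  refine ⟨hp, hscore, fun β hβ => hball β ?_, heig b hb, ?_, fun i => key (norm_pow_le_envelope _),
    fun i => key (resid_pow_le_envelope _ hb), fun i => key (deriv_pow_le_envelope _ hb),
    fun i β hβ => ?_, fun i => ?_, hnd⟩
  · calc ‖β - βt‖ ≤ ‖β - b‖ + ‖b - βt‖ := norm_sub_le_norm_sub_add_norm_sub _ _ _
      _ ≤ 2 * ρ := by linarith
  · rw [← ENNReal.toReal_sum fun i _ => hfin i]
    exact ENNReal.toReal_le_of_le_ofReal (by positivity) henv
  · exact (hlip i β hβ b hb).trans (mul_le_mul_of_nonneg_right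
      ((le_abs_self _).trans (key (abs_le_envelope _))) (norm_nonneg _))
  · rw [le_div_iff₀ hr]
    refine le_trans ?_ ((le_abs_self _).trans hwt)
    gcongr
    exact le_ciSup (f := fun i => ((N : ℝ) * p i)⁻¹) (Set.finite_range _).bddAbove i

/-! ### Tightness and the law of large numbers. -/

section Probability

/-- Averages of identically distributed integrable nonnegative variables are tight. -/
lemma exists_measure_sum_gt_le {Ω : Type*} [MeasurableSpace Ω] {P : Measure Ω}
    {Z : ℕ → Ω → ℝ≥0∞} (hZ : ∀ i, Measurable (Z i))
    (hident : ∀ i, ∫⁻ ω, Z i ω ∂P = ∫⁻ ω, Z 0 ω ∂P) (hfin : ∫⁻ ω, Z 0 ω ∂P < ∞) {η : ℝ≥0∞}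
    (hη : 0 < η) :
    ∃ K : ℝ, 0 < K ∧ ∀ N : ℕ, 0 < N →
      P {ω | ¬ ∑ i : Fin N, Z i ω ≤ ENNReal.ofReal (K * N)} ≤ η := by
  obtain ⟨K, hK, hKη⟩ := ENNReal.exists_nat_pos_mul_gt hη.ne' hfin.ne
  refine ⟨K, by exact_mod_cast hK, fun N hN => ?_⟩
  have hKN : ENNReal.ofReal (K * N) = (K : ℝ≥0∞) * N := by
    rw [← Nat.cast_mul, ENNReal.ofReal_natCast, Nat.cast_mul]
  have hmeas : Measurable fun ω => ∑ i : Fin N, Z i ω := Finset.measurable_fun_sum _ fun i _ => hZ i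
  have hK0 : (K : ℝ≥0∞) ≠ 0 := by exact_mod_cast hK.ne'
  have hN0 : (N : ℝ≥0∞) ≠ 0 := by exact_mod_cast hN.ne'
  calc _ ≤ P {ω | (K : ℝ≥0∞) * N ≤ ∑ i : Fin N, Z i ω} := by
        refine measure_mono fun ω hω => ?_
        rw [Set.mem_ofPred_eq, hKN, not_le] at hω
        exact hω.le
    _ ≤ (∫⁻ ω, ∑ i : Fin N, Z i ω ∂P) / ((K : ℝ≥0∞) * N) :=
        meas_ge_le_lintegral_div hmeas.aemeasurable (mul_ne_zero hK0 hN0)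
          (ENNReal.mul_ne_top (ENNReal.natCast_ne_top _) (ENNReal.natCast_ne_top _))
    _ = (N * ∫⁻ ω, Z 0 ω ∂P) / ((K : ℝ≥0∞) * N) := by
        rw [lintegral_finsetSum (f := fun (i : Fin N) ω => Z i ω) _ fun i _ => hZ i]
        simp [hident]
    _ ≤ (N * (K * η)) / ((K : ℝ≥0∞) * N) := by gcongr
    _ = η := by
        rw [← mul_assoc, mul_comm (N : ℝ≥0∞), mul_comm _ η]
        exact ENNReal.mul_div_cancel_right (mul_ne_zero hK0 hN0)
          (ENNReal.mul_ne_top (ENNReal.natCast_ne_top _) (ENNReal.natCast_ne_top _))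

/-- Only monotonicity and subadditivity enter, so the events need not be measurable. -/
lemma eventually_measure_not_and_le {Ω : Type*} [MeasurableSpace Ω] {P : Measure Ω}
    {A A' : ℕ → Ω → Prop} {η η' : ℝ≥0∞}
    (h : ∀ᶠ k in atTop, P {ω | ¬ A k ω} ≤ η) (h' : ∀ᶠ k in atTop, P {ω | ¬ A' k ω} ≤ η') :
    ∀ᶠ k in atTop, P {ω | ¬ (A k ω ∧ A' k ω)} ≤ η + η' := by
  filter_upwards [h, h'] with k hk hk'
  refine (measure_mono ?_).trans ((measure_union_le _ _).trans (add_le_add hk hk'))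
  intro ω hω
  exact not_and_or.1 hω

variable {Ω : Type*} [MeasurableSpace Ω] {P : Measure Ω} [IsProbabilityMeasure P] {d : ℕ}

lemma integrable_of_norm_le_envelope {F : Type*} [NormedAddCommGroup F] {f : Ω → F}
    (hf : AEStronglyMeasurable f P) {W : Ω → ℝ≥0∞} (hW : ∫⁻ ω, W ω ∂P < ∞) {u v : Ω → ℝ}
    (hu : ∀ ω, ENNReal.ofReal (u ω ^ 6) ≤ W ω) (hv : ∀ ω, ENNReal.ofReal (v ω ^ 6) ≤ W ω)
    (h : ∀ ω, ‖f ω‖ ≤ 1 + u ω ^ 6 + v ω ^ 6) : Integrable f P := by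
  refine ⟨hf, ?_⟩
  rw [hasFiniteIntegral_iff_norm]
  calc ∫⁻ ω, ENNReal.ofReal ‖f ω‖ ∂P ≤ ∫⁻ ω, (1 + 2 * W ω) ∂P := by
        refine lintegral_mono fun ω => (ENNReal.ofReal_le_ofReal (h ω)).trans ?_
        rw [add_assoc, two_mul]
        refine ENNReal.ofReal_add_le.trans (add_le_add (by simp)
          (ENNReal.ofReal_add_le.trans (add_le_add (hu ω) (hv ω))))
    _ = 1 + 2 * ∫⁻ ω, W ω ∂P := by
        rw [lintegral_add_left measurable_const, lintegral_const_mul' _ _ (by norm_num)]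
        simp
    _ < ∞ := ENNReal.add_lt_top.2 ⟨by norm_num, ENNReal.mul_lt_top (by norm_num) hW⟩

lemma abs_le_one_add_pow_six (u : ℝ) : |u| ≤ 1 + u ^ 6 := by
  rw [← Even.pow_abs (show Even 6 by decide)]
  rcases le_total |u| 1 with h | h
  · linarith [pow_nonneg (abs_nonneg u) 6]
  · linarith [le_self_pow₀ h (show 6 ≠ 0 by norm_num)]

/-- The estimating function has mean zero at the true parameter. -/
lemma integral_resid_smul_eq_zero {X : Ω → Vec d} {Y : Ω → ℝ} (hX : Measurable X)
    {g : Vec d → ℝ} (hg : Measurable g)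
    (h_model : P[Y | MeasurableSpace.comap X inferInstance] =ᵐ[P] fun ω => g (X ω))
    (hY : Integrable Y P) (hR : Integrable (fun ω => Y ω - g (X ω)) P)
    (hRX : Integrable (fun ω => (Y ω - g (X ω)) • X ω) P) :
    ∫ ω, (Y ω - g (X ω)) • X ω ∂P = 0 := by
  refine ext_inner_left ℝ fun u => ?_
  rw [inner_zero_right, ← integral_inner hRX]
  have hm : MeasurableSpace.comap X inferInstance ≤ (inferInstance : MeasurableSpace Ω) :=
    hX.comap_le
  have hXm : Measurable[MeasurableSpace.comap X inferInstance] X := comap_measurable X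
  have hgi : Integrable (fun ω => g (X ω)) P :=
    (hY.sub hR).congr (Eventually.of_forall fun ω => by simp)
  have hprod : Integrable ((fun ω => Y ω - g (X ω)) * fun ω => ⟪u, X ω⟫) P := by
    refine (hRX.const_inner u).congr (Eventually.of_forall fun ω => ?_)
    simp [real_inner_smul_right]
  have hgm : StronglyMeasurable[MeasurableSpace.comap X inferInstance] fun ω => g (X ω) :=
    (hg.comp hXm).stronglyMeasurable
  have hum : StronglyMeasurable[MeasurableSpace.comap X inferInstance] fun ω => ⟪u, X ω⟫ :=
    ((by fun_prop : Measurable fun x : Vec d => ⟪u, x⟫).comp hXm).stronglyMeasurable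
  -- The factor `⟪u, X⟫` is known given `X`, so it leaves the conditional expectation, and the
  -- residual has conditional mean zero.
  have h1 := condExp_mul_of_stronglyMeasurable_right hum hprod hR
  have h2 : P[fun ω => Y ω - g (X ω) | MeasurableSpace.comap X inferInstance] =ᵐ[P] 0 := by
    have := condExp_sub hY hgi (MeasurableSpace.comap X inferInstance)
    rw [condExp_of_stronglyMeasurable hm hgm hgi] at this
    refine EventuallyEq.trans this ?_
    filter_upwards [h_model] with ω hω
    simp [hω]
  have h3 := integral_condExp (μ := P) (f := (fun ω => Y ω - g (X ω)) * fun ω => ⟪u, X ω⟫) hm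
  calc ∫ ω, ⟪u, (Y ω - g (X ω)) • X ω⟫ ∂P
      = ∫ ω, ((fun ω => Y ω - g (X ω)) * fun ω => ⟪u, X ω⟫) ω ∂P := by
        simp [real_inner_smul_right]
    _ = 0 := by
        rw [← h3]
        refine integral_eq_zero_of_ae (h1.trans ?_)
        filter_upwards [h2] with ω hω
        simp [hω]

/-- The normalized estimating function at the true parameter tends to zero in probability. -/
lemma tendsto_measure_fullScore {X : ℕ → Ω → Vec d} {Y : ℕ → Ω → ℝ} (hX : ∀ i, Measurable (X i))
    (hY : ∀ i, Measurable (Y i)) (h_indep : iIndepFun (fun i ω => (X i ω, Y i ω)) P)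
    (h_ident : ∀ i, IdentDistrib (fun ω => (X i ω, Y i ω)) (fun ω => (X 0 ω, Y 0 ω)) P P)
    {ψ : ℝ → ℝ} (hψ : Continuous ψ) {βt : Vec d}
    (h_model : P[Y 0 | MeasurableSpace.comap (X 0) inferInstance] =ᵐ[P] fun ω => ψ ⟪βt, X 0 ω⟫)
    (hYi : Integrable (Y 0) P) (hR : Integrable (fun ω => Y 0 ω - ψ ⟪βt, X 0 ω⟫) P)
    (hRX : Integrable (fun ω => (Y 0 ω - ψ ⟪βt, X 0 ω⟫) • X 0 ω) P) {ε : ℝ} (hε : 0 < ε) :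
    Tendsto (fun N : ℕ => P {ω | ¬ ‖(N : ℝ)⁻¹ • fullScore ψ (fullData X Y N ω) βt‖ ≤ ε})
      atTop (𝓝 0) := by
  let g : Vec d × ℝ → Vec d := fun z => (z.2 - ψ ⟪βt, z.1⟫) • z.1
  have hg : Measurable g := by
    have : Measurable ψ := hψ.measurable
    fun_prop
  let Z : ℕ → Ω → Vec d := fun i ω => g (X i ω, Y i ω)
  have hZm (i : ℕ) : Measurable (Z i) := hg.comp ((hX i).prodMk (hY i))
  have hlaw := strong_law_ae (μ := P) Z hRX
    (fun i j hij => (h_indep.comp (fun _ => g) fun _ => hg).indepFun hij)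
    fun i => (h_ident i).comp hg
  have hmean : ∫ ω, Z 0 ω ∂P = 0 :=
    integral_resid_smul_eq_zero (hX 0) (g := fun x => ψ ⟪βt, x⟫)
      (hψ.measurable.comp (by fun_prop)) h_model hYi hR hRX
  rw [hmean] at hlaw
  have hmeas (N : ℕ) : Measurable fun ω => (N : ℝ)⁻¹ • ∑ i ∈ Finset.range N, Z i ω :=
    (Finset.measurable_fun_sum _ fun i _ => hZm i).const_smul (N : ℝ)⁻¹
  have hconv := tendstoInMeasure_iff_norm.1 (tendstoInMeasure_of_tendsto_ae
    (fun N => (hmeas N).aestronglyMeasurable) hlaw) ε hε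
  refine tendsto_of_tendsto_of_tendsto_of_le_of_le tendsto_const_nhds hconv (fun _ => zero_le)
    fun N => measure_mono fun ω hω => ?_
  rw [Set.mem_ofPred_eq, not_le] at hω
  have heq : fullScore ψ (fullData X Y N ω) βt = ∑ i ∈ Finset.range N, Z i ω :=
    Fin.sum_univ_eq_sum_range (fun i => Z i ω) N
  rw [heq] at hω
  simpa using hω.le

end Probability

lemma abs_mul_le_one_add_pow_six (u : ℝ) {v : ℝ} (hv : 0 ≤ v) :
    |u| * v ≤ 1 + u ^ 6 + v ^ 6 := by
  have key (x : ℝ) : x ^ 2 ≤ 1 + x ^ 6 := by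
    rcases le_total |x| 1 with h | h
    · have := pow_le_one₀ (n := 2) (abs_nonneg x) h
      rw [sq_abs] at this
      linarith [Even.pow_nonneg (show Even 6 by decide) x]
    · have := pow_le_pow_right₀ h (show 2 ≤ 6 by norm_num)
      rw [sq_abs, Even.pow_abs (by decide)] at this
      linarith
  nlinarith [key u, key v, sq_nonneg (|u| - v), sq_abs u,
    Even.pow_nonneg (show Even 6 by decide) u, pow_nonneg hv 6]

end PoissonQL

/-! ### Random data are regular with high probability. -/

theorem theorem2
    {Ω : Type*} [MeasurableSpace Ω] (P : Measure Ω) [IsProbabilityMeasure P] (d : ℕ)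
    -- i.i.d. observations and the quasi-likelihood model
    (X : ℕ → Ω → PoissonQL.Vec d) (Y : ℕ → Ω → ℝ)
    (hX : ∀ i, Measurable (X i)) (hY : ∀ i, Measurable (Y i))
    (h_indep : iIndepFun (fun i ω => (X i ω, Y i ω)) P)
    (h_ident : ∀ i, IdentDistrib (fun ω => (X i ω, Y i ω)) (fun ω => (X 0 ω, Y 0 ω)) P P)
    (ψ : ℝ → ℝ) (hψ : ContDiff ℝ 2 ψ) (hψ_pos : ∀ t, 0 < deriv ψ t)
    (βt : PoissonQL.Vec d)
    (h_model : ∀ i, P[Y i | MeasurableSpace.comap (X i) inferInstance]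
      =ᵐ[P] fun ω => ψ ⟪βt, X i ω⟫)
    -- the full-data estimator solves the estimating equation, and it and the true parameter
    -- are interior points of the parameter space
    (B : ℝ) (hβt : βt ∈ interior (PoissonQL.paramBall d B))
    (βhat : (N : ℕ) → PoissonQL.Data d N → PoissonQL.Vec d)
    (hβhat : Tendsto (fun N : ℕ => P {ω |
        ¬ (PoissonQL.fullScore ψ (PoissonQL.fullData X Y N ω)
              (βhat N (PoissonQL.fullData X Y N ω)) = 0 ∧
            βhat N (PoissonQL.fullData X Y N ω) ∈ interior (PoissonQL.paramBall d B))})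
      atTop (𝓝 0))
    -- moment conditions
    (h_mom_x : Integrable (fun ω => ‖X 0 ω‖ ^ 9) P)
    (h_mom_y : Integrable (fun ω => |Y 0 ω| ^ 6) P)
    (h_mom_psi : ∫⁻ ω, ⨆ β ∈ PoissonQL.paramBall d B,
      ENNReal.ofReal (ψ ⟪β, X 0 ω⟫ ^ 6) ∂P < ∞)
    (h_mom_dpsi : ∫⁻ ω, ⨆ β ∈ PoissonQL.paramBall d B,
      ENNReal.ofReal (deriv ψ ⟪β, X 0 ω⟫ ^ 6) ∂P < ∞)
    -- the smallest eigenvalue of the information matrix is bounded away from zero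
    (h_eig : ∃ c : ℝ, 0 < c ∧ Tendsto (fun N : ℕ => P {ω |
        ¬ ∀ β ∈ PoissonQL.paramBall d B,
            (PoissonQL.sigmaPsi ψ (PoissonQL.fullData X Y N ω) β
              - c • (1 : Matrix (Fin d) (Fin d) ℝ)).PosSemidef})
      atTop (𝓝 0))
    -- Lipschitz conditions
    (m₁ m₂ : PoissonQL.Vec d → ℝ) (hm₁ : Measurable m₁) (hm₂ : Measurable m₂)
    (h_lip₁ : ∀ i, ∀ᵐ ω ∂P, ∀ β₁ ∈ PoissonQL.paramBall d B, ∀ β₂ ∈ PoissonQL.paramBall d B,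
      |ψ ⟪β₁, X i ω⟫ - ψ ⟪β₂, X i ω⟫| ≤ m₁ (X i ω) * ‖β₁ - β₂‖)
    (h_lip₂ : ∀ i, ∀ᵐ ω ∂P, ∀ β₁ ∈ PoissonQL.paramBall d B, ∀ β₂ ∈ PoissonQL.paramBall d B,
      ‖PoissonQL.op (deriv ψ ⟪β₁, X i ω⟫ • PoissonQL.outer (X i ω)
          - deriv ψ ⟪β₂, X i ω⟫ • PoissonQL.outer (X i ω))‖ ≤ m₂ (X i ω) * ‖β₁ - β₂‖)
    (hm₁_int : Integrable (fun ω => m₁ (X 0 ω) ^ 3) P)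
    (hm₂_int : Integrable (fun ω => m₂ (X 0 ω)) P)
    -- Poisson subsampling along full-data sizes `n k` tending to infinity, with positive
    -- probabilities computed from the full data, and expected subsample size tending to infinity
    (n : ℕ → ℕ) (hn : Tendsto n atTop atTop)
    (p : (k : ℕ) → PoissonQL.Data d (n k) → Fin (n k) → I)
    (hp : ∀ k D i, 0 < p k D i)
    (hr : ∀ C : ℝ, Tendsto (fun k =>
      P {ω | PoissonQL.expSize (p k (PoissonQL.fullData X Y (n k) ω)) ≤ C}) atTop (𝓝 0))
    -- `max_i (N p_i)⁻¹ = O_P(r⁻¹)`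
    (h_wt : PoissonQL.BoundedInProb P (fun k ω =>
      (⨆ i, ((n k : ℝ) * (p k (PoissonQL.fullData X Y (n k) ω) i : ℝ))⁻¹)
        * PoissonQL.expSize (p k (PoissonQL.fullData X Y (n k) ω))))
    -- nondegeneracy: `V_c⁻¹ = O_P(r)`
    (h_nondeg : ∀ ε : ℝ≥0∞, 0 < ε → ∃ c : ℝ, 0 < c ∧ ∀ᶠ k in atTop, P {ω |
        ¬ (PoissonQL.expSize (p k (PoissonQL.fullData X Y (n k) ω)) •
              PoissonQL.varC ψ (PoissonQL.fullData X Y (n k) ω)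
                (p k (PoissonQL.fullData X Y (n k) ω))
                (βhat (n k) (PoissonQL.fullData X Y (n k) ω))
            - c • (1 : Matrix (Fin d) (Fin d) ℝ)).PosSemidef} ≤ ε)
    -- the subsample estimator: a root of the weighted estimating equation, whenever this
    -- equation can be solved in the parameter space
    (βtil : (k : ℕ) → PoissonQL.Data d (n k) → (Fin (n k) → Bool) → PoissonQL.Vec d)
    (hβtil : ∀ k D δ,
      (∃ β ∈ PoissonQL.paramBall d B, PoissonQL.subsampleScore ψ D (p k D) δ β = 0) →
        PoissonQL.subsampleScore ψ D (p k D) δ (βtil k D δ) = 0) :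
    -- conditionally on the full data, in probability, the standardized error converges in
    -- distribution to the standard normal law
    ∀ f : PoissonQL.Vec d →ᵇ ℝ,
      TendstoInMeasure P
        (fun k ω =>
          ∫ δ, f (PoissonQL.op
              (PoissonQL.invSqrt (PoissonQL.varV ψ (PoissonQL.fullData X Y (n k) ω)
                (p k (PoissonQL.fullData X Y (n k) ω))
                (βhat (n k) (PoissonQL.fullData X Y (n k) ω))))
              (βtil k (PoissonQL.fullData X Y (n k) ω) δ
                - βhat (n k) (PoissonQL.fullData X Y (n k) ω)))
            ∂(PoissonQL.subsampleLaw (p k (PoissonQL.fullData X Y (n k) ω))))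
        atTop (fun _ => ∫ z, f z ∂(stdGaussian (PoissonQL.Vec d))) := by
  intro f
  obtain ⟨c, hc, h_eig⟩ := h_eig
  obtain ⟨ρ₀, hρ₀, hball⟩ := Metric.isOpen_iff.1 isOpen_interior βt hβt
  have hβt' : βt ∈ PoissonQL.paramBall d B := interior_subset hβt
  -- With a third, the closed ball of radius `2 * ρ` fits in the open ball of radius `ρ₀`.
  set ρ := ρ₀ / 3 with hρ_def
  have hρ : 0 < ρ := by positivity
  have hball' (β : PoissonQL.Vec d) (hβ : ‖β - βt‖ ≤ 2 * ρ) : β ∈ PoissonQL.paramBall d B :=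
    interior_subset (hball (mem_ball_iff_norm.2 (by linarith)))
  let W : ℕ → Ω → ℝ≥0∞ := fun i ω => PoissonQL.envelope ψ B m₂ (X i ω, Y i ω)
  have hWm (i : ℕ) : Measurable (W i) :=
    (PoissonQL.measurable_envelope hψ hm₂).comp ((hX i).prodMk (hY i))
  have hW : ∫⁻ ω, W 0 ω ∂P < ∞ := PoissonQL.lintegral_envelope_lt_top (hX 0) (hY 0) hψ h_mom_x
    h_mom_y h_mom_psi h_mom_dpsi hm₂_int
  have hWident (i : ℕ) : ∫⁻ ω, W i ω ∂P = ∫⁻ ω, W 0 ω ∂P :=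
    ((h_ident i).comp (PoissonQL.measurable_envelope hψ hm₂)).lintegral_eq
  have hψXm : Measurable fun ω => ψ ⟪βt, X 0 ω⟫ :=
    hψ.continuous.measurable.comp (by have := hX 0; fun_prop)
  have hYi : Integrable (Y 0) P :=
    ((integrable_const 1).add h_mom_y).mono' (hY 0).aestronglyMeasurable
      (Eventually.of_forall fun ω => by
        have := PoissonQL.abs_le_one_add_pow_six (Y 0 ω)
        rwa [← Even.pow_abs (by decide)] at this)
  have hres (ω : Ω) : ENNReal.ofReal ((Y 0 ω - ψ ⟪βt, X 0 ω⟫) ^ 6) ≤ W 0 ω :=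
    PoissonQL.resid_pow_le_envelope (X 0 ω, Y 0 ω) hβt'
  have hnorm (ω : Ω) : ENNReal.ofReal (‖X 0 ω‖ ^ 6) ≤ W 0 ω :=
    PoissonQL.norm_pow_le_envelope (X 0 ω, Y 0 ω)
  have hR : Integrable (fun ω => Y 0 ω - ψ ⟪βt, X 0 ω⟫) P :=
    PoissonQL.integrable_of_norm_le_envelope ((hY 0).sub hψXm).aestronglyMeasurable hW hres hnorm
      fun ω => (PoissonQL.abs_le_one_add_pow_six _).trans (le_add_of_nonneg_right (by positivity))
  have hRX : Integrable (fun ω => (Y 0 ω - ψ ⟪βt, X 0 ω⟫) • X 0 ω) P :=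
    PoissonQL.integrable_of_norm_le_envelope
      (((hY 0).sub hψXm).smul (hX 0)).aestronglyMeasurable hW hres hnorm fun ω => by
        rw [norm_smul, Real.norm_eq_abs]
        exact PoissonQL.abs_mul_le_one_add_pow_six _ (norm_nonneg _)
  have hscore := PoissonQL.tendsto_measure_fullScore hX hY h_indep h_ident hψ.continuous
    (h_model 0) hYi hR hRX (mul_pos hc hρ)
  have hlip : ∀ᵐ ω ∂P, ∀ i, ∀ β₁ ∈ PoissonQL.paramBall d B, ∀ β₂ ∈ PoissonQL.paramBall d B,
      ‖PoissonQL.op (deriv ψ ⟪β₁, X i ω⟫ • PoissonQL.outer (X i ω)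
          - deriv ψ ⟪β₂, X i ω⟫ • PoissonQL.outer (X i ω))‖ ≤ m₂ (X i ω) * ‖β₁ - β₂‖ :=
    ae_all_iff.2 h_lip₂
  rw [tendstoInMeasure_iff_dist]
  intro ε hε
  rw [ENNReal.tendsto_nhds_zero]
  intro η hη
  -- Eight exceptional events share the budget `η`.
  set η' := η / 8 with hη'_def
  have hη' : 0 < η' := ENNReal.div_pos hη.ne' (by norm_num)
  have hη8 : η' + (η' + (η' + (η' + (η' + (η' + (η' + η')))))) = η := by
    rw [show η' + (η' + (η' + (η' + (η' + (η' + (η' + η')))))) = η' * 8 by ring, hη'_def]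
    exact ENNReal.div_mul_cancel (by norm_num) (by norm_num)
  obtain ⟨K, hK, hKW⟩ := PoissonQL.exists_measure_sum_gt_le hWm hWident hW hη'
  obtain ⟨C, hC⟩ := h_wt η' hη'
  obtain ⟨c', hc', hnd⟩ := h_nondeg η' hη'
  obtain ⟨R, hRf⟩ := PoissonQL.exists_expSize_forall_regular hψ hψ_pos B (K := K) (C := max C 0)
    hc hρ (le_max_right _ _) hc' f hε
  have ev {u : ℕ → ℝ≥0∞} (h : Tendsto u atTop (𝓝 0)) : ∀ᶠ k in atTop, u k ≤ η' :=
    ENNReal.tendsto_nhds_zero.1 h η' hη'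
  have e1 := ev (hβhat.comp hn)
  have e2 := ev (h_eig.comp hn)
  have e3 := ev (hscore.comp hn)
  have e4 : ∀ᶠ k in atTop, P {ω | ¬ ∑ i : Fin (n k), W i ω ≤ ENNReal.ofReal (K * n k)} ≤ η' :=
    (hn.eventually_gt_atTop 0).mono fun k hk => hKW (n k) hk
  have e5 : ∀ᶠ _ : ℕ in atTop, P {ω | ¬ ∀ i, ∀ β₁ ∈ PoissonQL.paramBall d B,
      ∀ β₂ ∈ PoissonQL.paramBall d B, ‖PoissonQL.op (deriv ψ ⟪β₁, X i ω⟫ • PoissonQL.outer (X i ω)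
          - deriv ψ ⟪β₂, X i ω⟫ • PoissonQL.outer (X i ω))‖ ≤ m₂ (X i ω) * ‖β₁ - β₂‖} ≤ η' :=
    Eventually.of_forall fun _ => (ae_iff.1 hlip).le.trans zero_le
  -- The maximum with `0` also secures `r > 0`, which excludes empty data.
  have e8 : ∀ᶠ k in atTop, P {ω | ¬ max R 0
      < PoissonQL.expSize (p k (PoissonQL.fullData X Y (n k) ω))} ≤ η' := by
    simpa only [not_lt] using ev (hr (max R 0))
  have hall := PoissonQL.eventually_measure_not_and_le e1
    (PoissonQL.eventually_measure_not_and_le e2 (PoissonQL.eventually_measure_not_and_le e3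
      (PoissonQL.eventually_measure_not_and_le e4 (PoissonQL.eventually_measure_not_and_le e5
        (PoissonQL.eventually_measure_not_and_le (by simpa only [← not_le] using hC)
          (PoissonQL.eventually_measure_not_and_le hnd e8))))))
  rw [hη8] at hall
  filter_upwards [hall] with k hk
  refine (measure_mono fun ω hω => ?_).trans hk
  rw [Set.mem_ofPred_eq] at hω ⊢
  -- Off the exceptional events the uniform theorem applies at the single point `ω`, with the
  -- realized data held fixed.
  rintro ⟨⟨hs, hb⟩, heig, hsmall, henv, hl, hwt, hndk, hrk⟩
  have hreg := PoissonQL.regular_of_bounds (m₂ := m₂) hψ hc hρ hK.le (hp k _) hs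
    (interior_subset hb) heig hball' hsmall henv (fun i => hl i)
    ((le_max_right _ _).trans_lt hrk) (hwt.trans (le_max_left C 0)) hndk
  have hlt := hRf _ _ _ _ _ (βtil k (PoissonQL.fullData X Y (n k) ω)) hreg
    ((le_max_left _ _).trans hrk.le) (hβtil k _)
  rw [Real.dist_eq] at hω
  exact absurd hlt (not_lt.2 hω)
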